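/- Let $d\ge 2$ be an integer, let $\mu_1,\dots,\mu_d>0$, and equip $\mathbb R^d$ with the mass scalar product $\langle x,y\rangle=\sum_{j=1}^d\mu_jx_jy_j$ and its norm $|x|=\sqrt{\langle x,x\rangle}$; $\nabla$ and $\nabla^2$ denote the gradient and the Hessian operator (with respect to $x$) in this metric, and $|\cdot|$ also denotes the corresponding operator norm of matrices. Let $\mathcal E=\{x\in\mathbb R^d:|x|=1\}$. For $\xi\in\mathcal E$, $R>0$, $\eta\in(0,1)$ put $$\mathcal T(\xi,R,\eta)=\Bigl\{x\in\mathbb R^d:\ |x|>R,\ \Bigl\langle \frac{x}{|x|},\xi\Bigr\rangle>\eta\Bigr\}.$$ **Theorem.** Let $\alpha\in(0,2)$. Let $\Sigma\subseteq\mathbb R^d\setminus\{0\}$ be an open set with $\lambda x\in\Sigma$ for all $x\in\Sigma$, $\lambda>0$, and let $U\in C^3(\Sigma,(0,+\infty))$ satisfy $U(\lambda x)=\lambda^{-\alpha}U(x)$ for all $x\in\Sigma$, $\lambda>0$. Let $\mathcal U=U|_{\mathcal E\cap\Sigma}$ and let $\xi^+\in\mathcal E\cap\Sigma$ be a central configuration,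 that is, a critical point of $\mathcal U$. Assume that the smallest eigenvalue $\nu_1$ of the Hessian $\nabla^2\mathcal U(\xi^+)$ of $\mathcal U$ (an operator on the tangent space $T_{\xi^+}\mathcal E$) satisfies the Barutello–Secchi condition $$\nu_1>-\frac{(2-\alpha)^2}{8}\,\mathcal U(\xi^+).$$ Let $R>0$, $\eta\in(0,1)$, and let $W\in C^2([0,+\infty)\times\mathcal T(\xi^+,R,\eta))$ satisfy $$|W(t,x)|+|x|\,|\nabla W(t,x)|+|x|^2\,|\nabla^2W(t,x)|=O(|x|^{-\beta})\qquad\text{as }|x|\to+\infty,\ \text{uniformly in }t,$$ for some $\beta\in\mathbb R$ with $4\beta-3\alpha>2$. Then there exist $R'\ge R$ and $\eta'\in[\eta,1)$ such that $\mathcal T(\xi^+,R',\eta')\subseteq\Sigma$ and, for every $x_0\in\mathcal T(\xi^+,R',\eta')$, there exists a solution $x$ of $$\ddot x=\nabla U(x)+\nabla W(t,x),$$ defined for all $t\in[0,+\infty)$ with values in $\Sigma\cap\mathcal T(\xi^+,R,\eta)$, such that $x(0)=x_0$, which is parabolic, i.e. $|x(t)|\to+\infty$ and $\dot x(t)\to0$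 as $t\to+\infty$, and satisfies $$\lim_{t\to+\infty}\frac{x(t)}{|x(t)|}=\xi^+,\qquad |x(t)|\sim\omega\,t^{\frac{2}{\alpha+2}}\ \text{ as }t\to+\infty,\qquad \omega=\Bigl(\frac{(\alpha+2)^2\,U(\xi^+)}{2}\Bigr)^{\frac1{\alpha+2}}.$$ -/

import Mathlib

open Set Filter Topology Asymptotics

/-- `ℝ^d` endowed with the mass scalar product `⟨x, y⟩ = ∑ j, μ j * x j * y j`, for positive
masses `μ`. The norm, the gradient and the operator norm on this type are the ones
of the mass metric. -/
def MassSpace {d : ℕ} (μ : Fin d → ℝ) (_hμ : ∀ j, 0 < μ j) : Type := Fin d → ℝ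

namespace MassSpace

variable {d : ℕ} (μ : Fin d → ℝ) (hμ : ∀ j, 0 < μ j)

instance instAddCommGroup : AddCommGroup (MassSpace μ hμ) :=
  inferInstanceAs (AddCommGroup (Fin d → ℝ))

instance instModule : Module ℝ (MassSpace μ hμ) :=
  inferInstanceAs (Module ℝ (Fin d → ℝ))

instance instFiniteDimensional : FiniteDimensional ℝ (MassSpace μ hμ) :=
  inferInstanceAs (FiniteDimensional ℝ (Fin d → ℝ))

/-- The mass scalar product. -/
@[reducible]
noncomputable def core : InnerProductSpace.Core ℝ (MassSpace μ hμ) where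
  inner x y := ∑ j, μ j * x j * y j
  conj_inner_symm x y := by
    simp only [conj_trivial]
    exact Finset.sum_congr rfl fun j _ => by ring
  re_inner_nonneg x := by
    simp only [RCLike.re_to_real]
    exact Finset.sum_nonneg fun j _ => by
      have := (hμ j).le
      have h2 := mul_self_nonneg (x j)
      rw [mul_assoc]
      positivity
  add_left x y z := by
    rw [← Finset.sum_add_distrib]
    refine Finset.sum_congr rfl fun j _ => ?_
    change μ j * (x j + y j) * z j = _
    ring
  smul_left x y r := by
    simp only [conj_trivial]
    rw [Finset.mul_sum]
    refine Finset.sum_congr rfl fun j _ => ?_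
    change μ j * (r * x j) * y j = _
    ring
  definite x hx := by
    have h0 : ∀ j ∈ Finset.univ, 0 ≤ μ j * x j * x j := fun j _ => by
      have := (hμ j).le
      have h2 := mul_self_nonneg (x j)
      rw [mul_assoc]
      positivity
    have h1 := (Finset.sum_eq_zero_iff_of_nonneg h0).1 hx
    funext j
    have h2 := h1 j (Finset.mem_univ j)
    have h3 := (hμ j).ne'
    change x j = 0
    simpa [h3] using h2

noncomputable instance instNormedAddCommGroup : NormedAddCommGroup (MassSpace μ hμ) :=
  @InnerProductSpace.Core.toNormedAddCommGroup ℝ (MassSpace μ hμ) _ _ _ (core μ hμ)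

noncomputable instance instInnerProductSpace : InnerProductSpace ℝ (MassSpace μ hμ) :=
  InnerProductSpace.ofCore (core μ hμ).toCore

instance instCompleteSpace : CompleteSpace (MassSpace μ hμ) :=
  FiniteDimensional.complete ℝ (MassSpace μ hμ)

theorem inner_def (x y : MassSpace μ hμ) : inner ℝ x y = ∑ j, μ j * x j * y j := rfl

end MassSpace

section Definitions

variable {E : Type*} [NormedAddCommGroup E] [InnerProductSpace ℝ E] [CompleteSpace E]

/-- `T(ξ, R, η) = {x : |x| > R, ⟨x / |x|, ξ⟩ > η}`. -/
def coneSet (ξ : E) (R η : ℝ) : Set E :=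
  {x | R < ‖x‖ ∧ η < inner ℝ (‖x‖⁻¹ • x) ξ}

/-- The Hessian `∇²F(x)`, as an operator: the derivative of the gradient. -/
noncomputable def hessian (F : E → ℝ) (x : E) : E →L[ℝ] E := fderiv ℝ (gradient F) x

/-- At a point `x` of the unit sphere, the Riemannian gradient of the restriction of `F` to the
unit sphere, i.e. the component of `∇F(x)` tangent to the sphere. (The formula also extends this
vector field to a neighbourhood of the sphere.) -/
noncomputable def sphereGradient (F : E → ℝ) (x : E) : E :=
  gradient F x - (inner ℝ (gradient F x) x : ℝ) • x

/-- At a point `ξ` of the unit sphere, the Riemannian Hessian of the restriction of `F` to the unit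
sphere, as an operator on the tangent space `ξᗮ`: the tangential component of the derivative
of the Riemannian gradient field (its Levi-Civita covariant derivative). -/
noncomputable def sphereHessian (F : E → ℝ) (ξ : E) :
    ((ℝ ∙ ξ)ᗮ : Submodule ℝ E) →L[ℝ] ((ℝ ∙ ξ)ᗮ : Submodule ℝ E) :=
  (ℝ ∙ ξ)ᗮ.orthogonalProjectionOnto ∘L fderiv ℝ (sphereGradient F) ξ ∘L (ℝ ∙ ξ)ᗮ.subtypeL

/-- `U` is a positive `C³` potential on the open cone `S ⊆ E ∖ {0}`, positively homogeneous
of degree `-α`. -/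
structure IsHomogeneousPotential (α : ℝ) (S : Set E) (U : E → ℝ) : Prop where
  isOpen : IsOpen S
  zero_notMem : (0 : E) ∉ S
  smul_mem : ∀ x ∈ S, ∀ r : ℝ, 0 < r → r • x ∈ S
  contDiffOn : ContDiffOn ℝ 3 U S
  pos : ∀ x ∈ S, 0 < U x
  homogeneous : ∀ x ∈ S, ∀ r : ℝ, 0 < r → U (r • x) = r ^ (-α) * U x

/-- `ξ` is a normalized central configuration: a critical point of the restriction of `U` to the
unit sphere (the inertia ellipsoid). -/
structure IsCentralConfiguration (S : Set E) (U : E → ℝ) (ξ : E) : Prop where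
  mem : ξ ∈ S
  norm_eq_one : ‖ξ‖ = 1
  critical : sphereGradient U ξ = 0

/-- The Barutello-Secchi condition: the smallest eigenvalue `ν₁` of the Hessian at `ξ` of the
restriction of `U` to the unit sphere satisfies `ν₁ > -((2 - α)² / 8) U(ξ)`. -/
def BSCondition (α : ℝ) (U : E → ℝ) (ξ : E) : Prop :=
  ∃ ν₁ : ℝ,
    IsLeast {ν : ℝ | Module.End.HasEigenvalue (sphereHessian U ξ).toLinearMap ν} ν₁ ∧
      ν₁ > -((2 - α) ^ 2 / 8) * U ξ

/-- `|W| + |x| |∇W| + |x|² |∇²W| = O(|x|^(-β))` as `|x| → +∞` in `D`, uniformly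
in `t ≥ 0`; derivatives are with respect to `x`. -/
def HasUniformDecay (β : ℝ) (D : Set E) (W : ℝ → E → ℝ) : Prop :=
  ∃ C ρ : ℝ, ∀ t : ℝ, 0 ≤ t → ∀ x ∈ D, ρ ≤ ‖x‖ →
    |W t x| + ‖x‖ * ‖gradient (W t) x‖ + ‖x‖ ^ 2 * ‖hessian (W t) x‖ ≤ C * ‖x‖ ^ (-β)

/-- `x : [0, +∞) → D` is a (classical) half-entire solution of `x'' = ∇U(x) + ∇W(t, x)`
that is parabolic: `|x(t)| → +∞` and `x'(t) → 0` as `t → +∞`. Here `v` is the velocity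
`x'`, and derivatives at `t = 0` are one-sided. -/
def IsParabolicSolution (U : E → ℝ) (W : ℝ → E → ℝ) (D : Set E) (x : ℝ → E) : Prop :=
  ∃ v : ℝ → E,
    (∀ t, 0 ≤ t → x t ∈ D) ∧
    (∀ t, 0 ≤ t → HasDerivWithinAt x (v t) (Ici 0) t) ∧
    (∀ t, 0 ≤ t → HasDerivWithinAt v (gradient U (x t) + gradient (W t) (x t)) (Ici 0) t) ∧
    Tendsto (fun t => ‖x t‖) atTop atTop ∧
    Tendsto v atTop (𝓝 0)

end Definitions

/-!
Let `q = 2 / (α + 2)` and `Ω = (α + 2)² U(ξ) / 2`. The unperturbed equation has the homothetic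
parabolic motion `Ω ^ (1 / (α + 2)) t ^ q ξ`; the required solution is found near this motion,
started at the time `t₀` when it is at distance `l = ‖x₀‖` from the origin. In the logarithmic
time `τ = log (1 + t / t₀)` and with the ansatz `x = l (e ^ (q τ) ξ + e ^ (τ / 2) ψ(τ))`,
homogeneity of `U` turns the equation of motion into

`ψ'' = ψ / 4 + Ω⁻¹ e ^ (θ τ) (∇U(ξ + e ^ (-θ τ) ψ) - ∇U(ξ)) + Ω⁻¹ l ^ (α + 1) e ^ (3 τ / 2) ∇W`,

where `θ = q - 1 / 2` is positive because `α < 2`. Any small `ψ` with bounded `ψ'` gives a parabolic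
motion with the claimed direction and growth (`isParabolicSolution_of_logTime`), so that it
suffices to find a small solution with the small initial value `ψ(0) = x₀ / ‖x₀‖ - ξ`.

* The linear part is `A = 1 / 4 + Ω⁻¹ ∇²U(ξ)`. On the radial direction it is positive by Euler's
  identity, and on the tangent space the Barutello-Secchi condition says exactly that it is
  positive (`IsHomogeneousPotential.exists_coercive_linearization`). Hence `‖A - κ‖ < κ` for a
  large scalar `κ` (`exists_norm_sub_smul_id_lt`).
* Near `ξ` the nonlinear part of `∇U` has an arbitrarily small Lipschitz constant. The perturbation
  contributes at most a constant times `l ^ (α - β) e ^ ((3 / 2 - q (β + 1)) τ)`, both in value and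
  in Lipschitz constant. As `4 β > 3 α + 2`, the exponent of `e` is negative; the same condition
  gives `β > α`, so that the perturbation is small for large `l`.
* The problem thus reads `ψ'' = κ ψ + g(τ, ψ)`, where `g` has a Lipschitz constant below `κ`. Since
  the bounded solution of `ψ'' = κ ψ + f` depends on `f` with gain `1 / κ` in the supremum norm,
  the contraction principle applies (`exists_bounded_solution`, `exists_logTime_solution`).
-/

/-! ### Bounded solutions of second order equations on a half-line -/

section BoundedSolutions

open MeasureTheory

variable {E : Type*} [NormedAddCommGroup E] [NormedSpace ℝ E]

/-- For bounded continuous `f`, the only bounded solution of `χ' = k χ + f`, where `k > 0`. -/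
noncomputable def unstableSolution (k : ℝ) (f : ℝ → E) (τ : ℝ) : E :=
  -(Real.exp (k * τ) • ∫ σ in Ioi τ, Real.exp (-k * σ) • f σ)

/-- The solution of `ψ' = -k ψ + χ` with initial value `ψ(0) = p`. -/
noncomputable def stableSolution (k : ℝ) (p : E) (χ : ℝ → E) (τ : ℝ) : E :=
  Real.exp (-k * τ) • (p + ∫ σ in (0 : ℝ)..τ, Real.exp (k * σ) • χ σ)

variable {k M : ℝ} {f g : ℝ → E}

theorem integrableOn_exp_smul_of_bounded (hk : 0 < k) (hf : Continuous f)
    (hM : ∀ τ, ‖f τ‖ ≤ M) (τ : ℝ) :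
    IntegrableOn (fun σ => Real.exp (-k * σ) • f σ) (Ioi τ) := by
  refine Integrable.mono' ((integrableOn_exp_mul_Ioi (neg_lt_zero.2 hk) τ).mul_const M) ?_ ?_
  · exact (by fun_prop : Continuous fun σ => Real.exp (-k * σ) • f σ).aestronglyMeasurable
  · refine Eventually.of_forall fun σ => ?_
    rw [norm_smul, Real.norm_eq_abs, Real.abs_exp]
    exact mul_le_mul_of_nonneg_left (hM σ) (Real.exp_pos _).le

theorem unstableSolution_sub (hk : 0 < k) (hf : Continuous f) (hg : Continuous g) {N : ℝ}
    (hM : ∀ τ, ‖f τ‖ ≤ M) (hN : ∀ τ, ‖g τ‖ ≤ N) (τ : ℝ) :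
    unstableSolution k f τ - unstableSolution k g τ = unstableSolution k (f - g) τ := by
  unfold unstableSolution
  simp only [Pi.sub_apply, smul_sub]
  rw [integral_sub (integrableOn_exp_smul_of_bounded hk hf hM τ)
    (integrableOn_exp_smul_of_bounded hk hg hN τ), smul_sub]
  abel

theorem norm_unstableSolution_le (hk : 0 < k) (hM : ∀ τ, ‖f τ‖ ≤ M) (τ : ℝ) :
    ‖unstableSolution k f τ‖ ≤ M / k := by
  have h1 : ‖∫ σ in Ioi τ, Real.exp (-k * σ) • f σ‖ ≤ ∫ σ in Ioi τ, Real.exp (-k * σ) * M := by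
    refine norm_integral_le_of_norm_le
      ((integrableOn_exp_mul_Ioi (neg_lt_zero.2 hk) τ).mul_const M) ?_
    refine Eventually.of_forall fun σ => ?_
    rw [norm_smul, Real.norm_eq_abs, Real.abs_exp]
    exact mul_le_mul_of_nonneg_left (hM σ) (Real.exp_pos _).le
  rw [integral_mul_const, integral_exp_mul_Ioi (neg_lt_zero.2 hk)] at h1
  rw [unstableSolution, norm_neg, norm_smul, Real.norm_eq_abs, Real.abs_exp]
  refine (mul_le_mul_of_nonneg_left h1 (Real.exp_pos _).le).trans_eq ?_
  have h2 : Real.exp (k * τ) * Real.exp (-k * τ) = 1 := by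
    rw [← Real.exp_add]; simp
  rw [neg_div_neg_eq, div_mul_eq_mul_div, ← mul_div_assoc, ← mul_assoc, h2, one_mul]

theorem hasDerivAt_exp_mul (k τ : ℝ) :
    HasDerivAt (fun s => Real.exp (k * s)) (k * Real.exp (k * τ)) τ := by
  simpa [mul_comm] using ((hasDerivAt_id τ).const_mul k).exp

theorem stableSolution_sub (p q : E) (hf : Continuous f) (hg : Continuous g) (τ : ℝ) :
    stableSolution k p f τ - stableSolution k q g τ = stableSolution k (p - q) (f - g) τ := by
  unfold stableSolution
  have h1 : ∀ h : ℝ → E, Continuous h →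
      IntervalIntegrable (fun σ => Real.exp (k * σ) • h σ) volume 0 τ := fun h hh =>
    (by fun_prop : Continuous fun σ => Real.exp (k * σ) • h σ).intervalIntegrable _ _
  simp only [Pi.sub_apply, smul_sub]
  rw [intervalIntegral.integral_sub (h1 f hf) (h1 g hg), ← smul_sub]
  congr 1
  abel

theorem norm_stableSolution_le (hk : 0 < k) (p : E) (hM : ∀ τ, ‖f τ‖ ≤ M) {τ : ℝ}
    (hτ : 0 ≤ τ) :
    ‖stableSolution k p f τ‖ ≤
      Real.exp (-k * τ) * ‖p‖ + (1 - Real.exp (-k * τ)) * (M / k) := by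
  have h1 : ‖∫ σ in (0 : ℝ)..τ, Real.exp (k * σ) • f σ‖ ≤
      ∫ σ in (0 : ℝ)..τ, Real.exp (k * σ) * M := by
    refine intervalIntegral.norm_integral_le_of_norm_le hτ ?_ ?_
    · refine Eventually.of_forall fun σ _ => ?_
      rw [norm_smul, Real.norm_eq_abs, Real.abs_exp]
      exact mul_le_mul_of_nonneg_left (hM σ) (Real.exp_pos _).le
    · exact (by fun_prop : Continuous fun σ => Real.exp (k * σ) * M).intervalIntegrable _ _
  have h2 : ∫ σ in (0 : ℝ)..τ, Real.exp (k * σ) * M = (Real.exp (k * τ) - 1) * (M / k) := by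
    have : ∀ σ ∈ uIcc 0 τ, HasDerivAt (fun s => Real.exp (k * s) * (M / k))
        (Real.exp (k * σ) * M) σ := by
      intro σ _
      refine ((hasDerivAt_exp_mul k σ).mul_const (M / k)).congr_deriv ?_
      field_simp
    rw [intervalIntegral.integral_eq_sub_of_hasDerivAt this
      ((by fun_prop : Continuous fun σ => Real.exp (k * σ) * M).intervalIntegrable _ _)]
    simp [sub_mul]
  rw [h2] at h1
  rw [stableSolution, norm_smul, Real.norm_eq_abs, Real.abs_exp]
  refine (mul_le_mul_of_nonneg_left ((norm_add_le _ _).trans (add_le_add_right h1 _))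
    (Real.exp_pos _).le).trans_eq ?_
  have h4 : Real.exp (-k * τ) * Real.exp (k * τ) = 1 := by
    rw [← Real.exp_add]; simp
  linear_combination (M / k) * h4

variable [CompleteSpace E]

theorem hasDerivAt_unstableSolution (hk : 0 < k) (hf : Continuous f) (hM : ∀ τ, ‖f τ‖ ≤ M)
    (τ : ℝ) :
    HasDerivAt (unstableSolution k f) (k • unstableSolution k f τ + f τ) τ := by
  have hc : Continuous fun σ => Real.exp (-k * σ) • f σ := by fun_prop
  have h1 : ∀ s, ∫ σ in Ioi s, Real.exp (-k * σ) • f σ =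
      (∫ σ in Ioi 0, Real.exp (-k * σ) • f σ) - ∫ σ in (0 : ℝ)..s, Real.exp (-k * σ) • f σ := by
    intro s
    rw [← intervalIntegral.integral_Ioi_sub_Ioi'
      (integrableOn_exp_smul_of_bounded hk hf hM 0) (integrableOn_exp_smul_of_bounded hk hf hM s)]
    abel
  have h2 : HasDerivAt (fun s => ∫ σ in Ioi s, Real.exp (-k * σ) • f σ)
      (-(Real.exp (-k * τ) • f τ)) τ := by
    rw [funext h1]
    exact (hc.integral_hasStrictDerivAt 0 τ).hasDerivAt.const_sub _
  have h3 := ((hasDerivAt_exp_mul k τ).smul h2).neg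
  refine h3.congr_deriv ?_
  have h4 : Real.exp (k * τ) * Real.exp (-k * τ) = 1 := by
    rw [← Real.exp_add]; simp
  rw [unstableSolution, smul_neg, smul_smul, smul_neg, smul_smul, h4, one_smul]
  abel

theorem hasDerivAt_stableSolution (p : E) (hf : Continuous f) (τ : ℝ) :
    HasDerivAt (stableSolution k p f) (-(k • stableSolution k p f τ) + f τ) τ := by
  have hc : Continuous fun σ => Real.exp (k * σ) • f σ := by fun_prop
  have h3 := (hasDerivAt_exp_mul (-k) τ).smul
    ((hc.integral_hasStrictDerivAt 0 τ).hasDerivAt.const_add p)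
  refine h3.congr_deriv ?_
  have h4 : Real.exp (-k * τ) * Real.exp (k * τ) = 1 := by
    rw [← Real.exp_add]; simp
  rw [stableSolution, smul_smul, smul_smul, h4, one_smul, neg_mul, neg_smul]
  abel

/-- Bounded solutions on the half-line of `ψ'' = k² ψ + g(τ, ψ)` with prescribed initial value,
for `g` with Lipschitz constant smaller than `k²`. The solution is the fixed point of a
contraction, because the linear problem `ψ'' = k² ψ + f` splits into the first order
equations `χ' = k χ + f` and `ψ' = -k ψ + χ`, each of which is solved with gain `1 / k` in the
supremum norm. -/
theorem exists_bounded_solution {k L δ : ℝ} (hk : 0 < k) (hL0 : 0 ≤ L) (hL : L < k ^ 2)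
    (hδ : 0 ≤ δ) {p : E} (hp : ‖p‖ ≤ δ) {g : ℝ → E → E}
    (hg : ContinuousOn (Function.uncurry g) (Ici (0 : ℝ) ×ˢ Metric.closedBall 0 δ))
    (hLip : ∀ τ, 0 ≤ τ → ∀ a ∈ Metric.closedBall (0 : E) δ, ∀ b ∈ Metric.closedBall (0 : E) δ,
      ‖g τ a - g τ b‖ ≤ L * ‖a - b‖)
    (hg0 : ∀ τ, 0 ≤ τ → ‖g τ 0‖ ≤ (k ^ 2 - L) * δ) :
    ∃ (ψ ψ' : ℝ → E) (M : ℝ), ψ 0 = p ∧ ∀ τ, 0 ≤ τ →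
      ‖ψ τ‖ ≤ δ ∧ ‖ψ' τ‖ ≤ M ∧ HasDerivWithinAt ψ (ψ' τ) (Ici 0) τ ∧
      HasDerivWithinAt ψ' (k ^ 2 • ψ τ + g τ (ψ τ)) (Ici 0) τ := by
  have hgb : ∀ τ, 0 ≤ τ → ∀ a ∈ Metric.closedBall (0 : E) δ, ‖g τ a‖ ≤ k ^ 2 * δ := by
    intro τ hτ a ha
    have h1 := hLip τ hτ a ha 0 (by simpa using hδ)
    have h2 := hg0 τ hτ
    have h3 : ‖a‖ ≤ δ := by simpa using ha
    have h4 : ‖g τ a‖ ≤ ‖g τ a - g τ 0‖ + ‖g τ 0‖ := by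
      simpa using norm_add_le (g τ a - g τ 0) (g τ 0)
    rw [sub_zero] at h1
    nlinarith [mul_le_mul_of_nonneg_left h3 hL0]
  let X := Metric.closedBall (0 : BoundedContinuousFunction ℝ E) δ
  have hXball : ∀ ψ : X, ∀ τ, (ψ : BoundedContinuousFunction ℝ E) τ ∈
      Metric.closedBall (0 : E) δ := by
    intro ψ τ
    have h1 : ‖(ψ : BoundedContinuousFunction ℝ E)‖ ≤ δ := mem_closedBall_zero_iff.1 ψ.2
    simpa using ((ψ : BoundedContinuousFunction ℝ E).norm_coe_le_norm τ).trans h1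
  -- The superposition operator, made to act on functions on the whole line.
  let f : X → ℝ → E := fun ψ τ => g (max τ 0) ((ψ : BoundedContinuousFunction ℝ E) τ)
  have hfc : ∀ ψ, Continuous (f ψ) := by
    intro ψ
    have : Continuous fun τ => (max τ 0, (ψ : BoundedContinuousFunction ℝ E) τ) := by fun_prop
    exact hg.comp_continuous this fun τ => ⟨le_max_right τ 0, hXball ψ τ⟩
  have hfb : ∀ ψ τ, ‖f ψ τ‖ ≤ k ^ 2 * δ := fun ψ τ =>
    hgb _ (le_max_right _ _) _ (hXball ψ τ)
  have hχc : ∀ ψ, Continuous (unstableSolution k (f ψ)) := fun ψ =>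
    continuous_iff_continuousAt.2 fun τ =>
      (hasDerivAt_unstableSolution hk (hfc ψ) (hfb ψ) τ).continuousAt
  have hχb : ∀ ψ τ, ‖unstableSolution k (f ψ) τ‖ ≤ k * δ := by
    intro ψ τ
    refine (norm_unstableSolution_le hk (hfb ψ) τ).trans_eq ?_
    field_simp
  let Ψ : X → ℝ → E := fun ψ => stableSolution k p (unstableSolution k (f ψ))
  have hΨd : ∀ ψ τ, HasDerivAt (Ψ ψ) (-(k • Ψ ψ τ) + unstableSolution k (f ψ) τ) τ :=
    fun ψ τ => hasDerivAt_stableSolution p (hχc ψ) τ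
  have hΨc : ∀ ψ, Continuous (Ψ ψ) := fun ψ =>
    continuous_iff_continuousAt.2 fun τ => (hΨd ψ τ).continuousAt
  have hexp : ∀ τ, 0 ≤ τ → Real.exp (-k * τ) ≤ 1 := fun τ hτ =>
    Real.exp_le_one_iff.2 (by nlinarith)
  have hΨb : ∀ ψ τ, 0 ≤ τ → ‖Ψ ψ τ‖ ≤ δ := by
    intro ψ τ hτ
    refine (norm_stableSolution_le hk p (hχb ψ) hτ).trans ?_
    rw [mul_div_cancel_left₀ _ hk.ne']
    nlinarith [mul_le_mul_of_nonneg_left hp (Real.exp_pos (-k * τ)).le]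
  let B : X → BoundedContinuousFunction ℝ E := fun ψ =>
    BoundedContinuousFunction.ofNormedAddCommGroup (fun τ => Ψ ψ (max τ 0))
      ((hΨc ψ).comp (by fun_prop)) δ fun τ => hΨb ψ _ (le_max_right _ _)
  have hBmem : ∀ ψ, B ψ ∈ X := by
    intro ψ
    rw [mem_closedBall_zero_iff]
    exact BoundedContinuousFunction.norm_ofNormedAddCommGroup_le _ hδ _
  let F : X → X := fun ψ => ⟨B ψ, hBmem ψ⟩
  have hk2 : 0 < k ^ 2 := by positivity
  have hF : ContractingWith (L / k ^ 2).toNNReal F := by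
    refine ⟨?_, LipschitzWith.of_dist_le_mul fun ψ φ => ?_⟩
    · rw [Real.toNNReal_lt_one, div_lt_one hk2]
      exact hL
    · rw [Real.coe_toNNReal _ (by positivity), Subtype.dist_eq, Subtype.dist_eq]
      refine (BoundedContinuousFunction.dist_le (by positivity)).2 fun τ => ?_
      change dist (Ψ ψ (max τ 0)) (Ψ φ (max τ 0)) ≤ _
      have hτ : 0 ≤ max τ 0 := le_max_right _ _
      have h1 : ∀ σ, ‖(f ψ - f φ) σ‖ ≤ L * dist (ψ : BoundedContinuousFunction ℝ E) φ := by
        intro σ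
        refine (hLip _ (le_max_right _ _) _ (hXball ψ σ) _ (hXball φ σ)).trans ?_
        rw [← dist_eq_norm]
        exact mul_le_mul_of_nonneg_left (BoundedContinuousFunction.dist_coe_le_dist σ) hL0
      have h2 : ∀ σ, ‖(unstableSolution k (f ψ) - unstableSolution k (f φ)) σ‖ ≤
          L * dist (ψ : BoundedContinuousFunction ℝ E) φ / k := by
        intro σ
        rw [Pi.sub_apply, unstableSolution_sub hk (hfc ψ) (hfc φ) (hfb ψ) (hfb φ)]
        exact norm_unstableSolution_le hk h1 σ
      rw [dist_eq_norm, stableSolution_sub p p (hχc ψ) (hχc φ)]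
      refine (norm_stableSolution_le hk (p - p) h2 hτ).trans ?_
      have h3 : 0 ≤ L * dist (ψ : BoundedContinuousFunction ℝ E) φ / k / k := by positivity
      rw [sub_self, norm_zero, mul_zero, zero_add]
      calc (1 - Real.exp (-k * max τ 0)) * (L * dist (ψ : BoundedContinuousFunction ℝ E) φ / k / k)
          ≤ 1 * (L * dist (ψ : BoundedContinuousFunction ℝ E) φ / k / k) :=
            mul_le_mul_of_nonneg_right (by linarith [Real.exp_pos (-k * max τ 0)]) h3
        _ = _ := by field_simp
  have hne : Nonempty X := ⟨⟨0, by simpa [X] using hδ⟩⟩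
  have hcompl : CompleteSpace X := Metric.isClosed_closedBall.completeSpace_coe
  let φ : X := hF.fixedPoint F
  have hφ : ∀ τ, 0 ≤ τ → Ψ φ τ = (φ : BoundedContinuousFunction ℝ E) τ := by
    intro τ hτ
    have h1 : F φ = φ := hF.fixedPoint_isFixedPt
    have h2 : (F φ : BoundedContinuousFunction ℝ E) τ = Ψ φ (max τ 0) := rfl
    rw [h1, max_eq_left hτ] at h2
    exact h2.symm
  refine ⟨Ψ φ, fun τ => -(k • Ψ φ τ) + unstableSolution k (f φ) τ, k * δ + k * δ, ?_, ?_⟩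
  · simp [Ψ, stableSolution]
  · intro τ hτ
    refine ⟨hΨb φ τ hτ, ?_, (hΨd φ τ).hasDerivWithinAt, ?_⟩
    · refine (norm_add_le _ _).trans (add_le_add ?_ (hχb φ τ))
      rw [norm_neg, norm_smul, Real.norm_of_nonneg hk.le]
      exact mul_le_mul_of_nonneg_left (hΨb φ τ hτ) hk.le
    · have h1 := (((hΨd φ τ).const_smul k).neg).add
        (hasDerivAt_unstableSolution hk (hfc φ) (hfb φ) τ)
      refine (h1.congr_deriv ?_).hasDerivWithinAt
      have h2 : f φ τ = g τ (Ψ φ τ) := by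
        simp only [f, max_eq_left hτ, hφ τ hτ]
      rw [h2, smul_add, smul_neg, smul_smul, pow_two]
      abel

end BoundedSolutions

/-! ### Gradients and Hessians of homogeneous potentials -/

section Homogeneous

variable {E : Type*} [NormedAddCommGroup E] [InnerProductSpace ℝ E] [CompleteSpace E]

theorem ContDiffOn.gradient_of_isOpen {F : E → ℝ} {s : Set E} {m n : WithTop ℕ∞}
    (hF : ContDiffOn ℝ n F s) (hs : IsOpen s) (hmn : m + 1 ≤ n) :
    ContDiffOn ℝ m (gradient F) s :=
  (InnerProductSpace.toDual ℝ E).symm.contDiff.comp_contDiffOn (hF.fderiv_of_isOpen hs hmn)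

/-- The Hessian operator is symmetric, by the symmetry of second derivatives. -/
theorem inner_hessian_comm {F : E → ℝ} {x : E} (hF : ContDiffAt ℝ 2 F x) (v w : E) :
    inner ℝ (hessian F x v) w = inner ℝ (hessian F x w) v := by
  have h1 : DifferentiableAt ℝ (fderiv ℝ F) x :=
    (hF.fderiv_right (m := 1) (by norm_num)).differentiableAt (by norm_num)
  have h2 : hessian F x =
      (InnerProductSpace.toDual ℝ E).symm.toContinuousLinearEquiv.toContinuousLinearMap ∘L
        fderiv ℝ (fderiv ℝ F) x :=
    ((InnerProductSpace.toDual ℝ E).symm.toContinuousLinearEquiv.toContinuousLinearMap.hasFDerivAt.comp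
      x h1.hasFDerivAt).fderiv
  have h3 : ∀ v w, inner ℝ (hessian F x v) w = fderiv ℝ (fderiv ℝ F) x v w := by
    intro v w
    rw [h2]
    exact InnerProductSpace.toDual_symm_apply
  rw [h3, h3]
  exact hF.isSymmSndFDerivAt (by simp) v w

namespace IsHomogeneousPotential

variable {α : ℝ} {S : Set E} {U : E → ℝ} {x : E}

omit [CompleteSpace E] in
theorem contDiffAt (hU : IsHomogeneousPotential α S U) (hx : x ∈ S) : ContDiffAt ℝ 3 U x :=
  hU.contDiffOn.contDiffAt (hU.isOpen.mem_nhds hx)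

theorem hasGradientAt (hU : IsHomogeneousPotential α S U) (hx : x ∈ S) :
    HasGradientAt U (gradient U x) x :=
  ((hU.contDiffAt hx).differentiableAt (by norm_num)).hasGradientAt

theorem contDiffOn_gradient (hU : IsHomogeneousPotential α S U) :
    ContDiffOn ℝ 2 (gradient U) S :=
  hU.contDiffOn.gradient_of_isOpen hU.isOpen (by norm_num)

theorem hasFDerivAt_gradient (hU : IsHomogeneousPotential α S U) (hx : x ∈ S) :
    HasFDerivAt (gradient U) (hessian U x) x :=
  ((hU.contDiffOn_gradient.contDiffAt (hU.isOpen.mem_nhds hx)).differentiableAt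
    (by norm_num)).hasFDerivAt

theorem gradient_smul (hU : IsHomogeneousPotential α S U) (hx : x ∈ S) {r : ℝ} (hr : 0 < r) :
    gradient U (r • x) = r ^ (-α - 1) • gradient U x := by
  have h1 : HasFDerivAt (fun y => U (r • y))
      ((InnerProductSpace.toDual ℝ E (gradient U (r • x))) ∘L
        (r • ContinuousLinearMap.id ℝ E)) x :=
    (hU.hasGradientAt (hU.smul_mem x hx r hr)).hasFDerivAt.comp x
      ((hasFDerivAt_id x).const_smul r)
  have h2 : HasFDerivAt (fun y => r ^ (-α) * U y)
      (r ^ (-α) • (InnerProductSpace.toDual ℝ E (gradient U x))) x :=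
    (hU.hasGradientAt hx).hasFDerivAt.const_mul _
  have h3 : (fun y => U (r • y)) =ᶠ[𝓝 x] fun y => r ^ (-α) * U y := by
    filter_upwards [hU.isOpen.mem_nhds hx] with y hy using hU.homogeneous y hy r hr
  have h4 := h1.unique (h2.congr_of_eventuallyEq h3)
  have h5 : r • gradient U (r • x) = r ^ (-α) • gradient U x := by
    refine ext_inner_right ℝ fun v => ?_
    have := DFunLike.congr_fun h4 v
    simpa [inner_smul_left, inner_smul_right] using this
  rw [Real.rpow_sub_one hr.ne', div_eq_inv_mul, mul_smul, ← h5, smul_smul,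
    inv_mul_cancel₀ hr.ne', one_smul]

omit [CompleteSpace E] in
theorem hasDerivAt_smul_self (x : E) : HasDerivAt (fun r : ℝ => r • x) x 1 := by
  simpa using (hasDerivAt_id (1 : ℝ)).smul_const x

/-- Euler's identity for `U`. -/
theorem inner_gradient_self (hU : IsHomogeneousPotential α S U) (hx : x ∈ S) :
    inner ℝ (gradient U x) x = -α * U x := by
  have h0 : HasFDerivAt U (InnerProductSpace.toDual ℝ E (gradient U x)) ((1 : ℝ) • x) := by
    rw [one_smul]; exact (hU.hasGradientAt hx).hasFDerivAt
  have h1 := h0.comp_hasDerivAt (1 : ℝ) (hasDerivAt_smul_self x)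
  have h2 : HasDerivAt (fun r : ℝ => r ^ (-α) * U x) (-α * U x) 1 := by
    simpa using (Real.hasDerivAt_rpow_const (p := -α) (Or.inl (one_ne_zero (α := ℝ)))).mul_const
      (U x)
  have h3 : (U ∘ fun r : ℝ => r • x) =ᶠ[𝓝 1] fun r : ℝ => r ^ (-α) * U x := by
    filter_upwards [lt_mem_nhds (zero_lt_one (α := ℝ))] with r hr using hU.homogeneous x hx r hr
  simpa using h1.unique (h2.congr_of_eventuallyEq h3)

/-- Euler's identity for `∇U`, which is homogeneous of degree `-α - 1`. -/
theorem hessian_self (hU : IsHomogeneousPotential α S U) (hx : x ∈ S) :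
    hessian U x x = -(α + 1) • gradient U x := by
  have h0 : HasFDerivAt (gradient U) (hessian U x) ((1 : ℝ) • x) := by
    rw [one_smul]; exact hU.hasFDerivAt_gradient hx
  have h1 := h0.comp_hasDerivAt (1 : ℝ) (hasDerivAt_smul_self x)
  have h2 : HasDerivAt (fun r : ℝ => r ^ (-α - 1) • gradient U x)
      ((-α - 1) • gradient U x) 1 := by
    simpa using (Real.hasDerivAt_rpow_const (p := -α - 1)
      (Or.inl (one_ne_zero (α := ℝ)))).smul_const (gradient U x)
  have h3 : (gradient U ∘ fun r : ℝ => r • x) =ᶠ[𝓝 1]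
      fun r : ℝ => r ^ (-α - 1) • gradient U x := by
    filter_upwards [lt_mem_nhds (zero_lt_one (α := ℝ))] with r hr using hU.gradient_smul hx hr
  rw [h1.unique (h2.congr_of_eventuallyEq h3)]
  congr 1
  ring

/-- At a central configuration the gradient is radial. -/
theorem gradient_eq_smul (hU : IsHomogeneousPotential α S U)
    (hξ : IsCentralConfiguration S U x) : gradient U x = (-α * U x) • x := by
  have h := hξ.critical
  rw [sphereGradient, hU.inner_gradient_self hξ.mem] at h
  exact sub_eq_zero.1 h

/-- On the tangent space of the sphere, the spherical Hessian differs from the Hessian of `U` by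
the curvature term `α U`. -/
theorem inner_sphereHessian (hU : IsHomogeneousPotential α S U) (hx : x ∈ S)
    (v w : ((ℝ ∙ x)ᗮ : Submodule ℝ E)) :
    inner ℝ (sphereHessian U x v) w =
      inner ℝ (hessian U x v) (w : E) + α * U x * inner ℝ (v : E) (w : E) := by
  have h1 : HasFDerivAt (fun y => gradient U y + (α * U y) • y)
      (hessian U x + ((α * U x) • ContinuousLinearMap.id ℝ E +
        (α • InnerProductSpace.toDual ℝ E (gradient U x)).smulRight x)) x :=
    (hU.hasFDerivAt_gradient hx).add
      (((hU.hasGradientAt hx).hasFDerivAt.const_mul α).smul (hasFDerivAt_id x))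
  have h2 : sphereGradient U =ᶠ[𝓝 x] fun y => gradient U y + (α * U y) • y := by
    filter_upwards [hU.isOpen.mem_nhds hx] with y hy
    rw [sphereGradient, hU.inner_gradient_self hy, neg_mul, neg_smul, sub_neg_eq_add]
  have h3 := (h1.congr_of_eventuallyEq h2).fderiv
  have hw : inner ℝ x (w : E) = 0 := Submodule.mem_orthogonal_singleton_iff_inner_right.1 w.2
  rw [sphereHessian, ContinuousLinearMap.comp_apply, ContinuousLinearMap.comp_apply,
    Submodule.inner_orthogonalProjectionOnto_eq_of_mem_right, h3]
  simp [inner_add_left, inner_smul_left, hw]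

theorem isSymmetric_sphereHessian (hU : IsHomogeneousPotential α S U) (hx : x ∈ S) :
    (sphereHessian U x).toLinearMap.IsSymmetric := by
  intro v w
  have h := inner_hessian_comm ((hU.contDiffAt hx).of_le (by norm_num)) (v : E) (w : E)
  rw [real_inner_comm]
  change inner ℝ _ (sphereHessian U x v) = inner ℝ _ (sphereHessian U x w)
  rw [real_inner_comm, real_inner_comm (sphereHessian U x w), hU.inner_sphereHessian hx,
    hU.inner_sphereHessian hx, h, real_inner_comm (v : E) (w : E)]

/-- The Barutello-Secchi condition bounds the Hessian of `U` from below on the tangent space. -/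
theorem le_inner_hessian_of_isLeast [FiniteDimensional ℝ E]
    (hU : IsHomogeneousPotential α S U) (hx : x ∈ S) {ν : ℝ}
    (hν : IsLeast {ν : ℝ | Module.End.HasEigenvalue (sphereHessian U x).toLinearMap ν} ν)
    {w : E} (hw : inner ℝ x w = 0) :
    (ν - α * U x) * ‖w‖ ^ 2 ≤ inner ℝ (hessian U x w) w := by
  rcases eq_or_ne w 0 with rfl | hw0
  · simp
  let V : Submodule ℝ E := (ℝ ∙ x)ᗮ
  let w' : V := ⟨w, Submodule.mem_orthogonal_singleton_iff_inner_right.2 hw⟩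
  have hw' : w' ≠ 0 := fun h => hw0 (congrArg Subtype.val h)
  have : Nontrivial V := ⟨w', 0, hw'⟩
  have h1 := hν.2 (hU.isSymmetric_sphereHessian hx).hasEigenvalue_iInf_of_finiteDimensional
  have hbdd : BddBelow (range fun v : {v : V // v ≠ 0} =>
      RCLike.re (inner ℝ ((sphereHessian U x).toLinearMap v) (v : V)) / ‖(v : V)‖ ^ 2) := by
    refine ⟨-‖sphereHessian U x‖, ?_⟩
    rintro _ ⟨v, rfl⟩
    exact (abs_le.1 ((sphereHessian U x).rayleighQuotient_le_norm (v : V))).1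
  have h2 := h1.trans (ciInf_le hbdd ⟨w', hw'⟩)
  have h3 : 0 < ‖w‖ ^ 2 := by positivity
  have h4 : ν ≤ inner ℝ (sphereHessian U x w') w' / ‖w‖ ^ 2 := h2
  rw [le_div_iff₀ h3, hU.inner_sphereHessian hx] at h4
  have h5 : inner ℝ (w' : E) (w' : E) = ‖w‖ ^ 2 := real_inner_self_eq_norm_sq w
  rw [h5] at h4
  change _ ≤ inner ℝ (hessian U x w) w + _ at h4
  linarith

/-- The linearization at the homothetic parabolic motion, in logarithmic time and after removal
of the factor `e ^ (τ / 2)`, is `ψ'' = ψ / 4 + Ω⁻¹ ∇²U(ξ) ψ` with `Ω = (α + 2)² U(ξ) / 2`.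
The Barutello-Secchi condition is exactly the positivity of this operator. -/
theorem exists_coercive_linearization [FiniteDimensional ℝ E] (hα0 : 0 < α)
    (hU : IsHomogeneousPotential α S U) (hξ : IsCentralConfiguration S U x)
    (hBS : BSCondition α U x) :
    ∃ m : ℝ, 0 < m ∧ ∀ v : E, m * ‖v‖ ^ 2 ≤
      4⁻¹ * ‖v‖ ^ 2 + ((α + 2) ^ 2 * U x / 2)⁻¹ * inner ℝ (hessian U x v) v := by
  obtain ⟨ν, hν, hνlt⟩ := hBS
  have hUp : 0 < U x := hU.pos x hξ.mem
  set Ω : ℝ := (α + 2) ^ 2 * U x / 2 with hΩ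
  have hΩp : 0 < Ω := by positivity
  have hmν : 0 < 4⁻¹ + Ω⁻¹ * (ν - α * U x) := by
    have h1 : -(Ω / 4) < ν - α * U x := by
      rw [hΩ]; nlinarith
    have h2 : Ω⁻¹ * -(Ω / 4) = -4⁻¹ := by field_simp
    have := mul_lt_mul_of_pos_left h1 (inv_pos.2 hΩp)
    linarith
  refine ⟨min 4⁻¹ (4⁻¹ + Ω⁻¹ * (ν - α * U x)), lt_min (by norm_num) hmν, fun v => ?_⟩
  set m := min 4⁻¹ (4⁻¹ + Ω⁻¹ * (ν - α * U x)) with hm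
  -- Split `v` into its radial and tangential components.
  let a : ℝ := inner ℝ x v
  let w : E := v - a • x
  have hxx : inner ℝ x x = 1 := by rw [real_inner_self_eq_norm_sq, hξ.norm_eq_one, one_pow]
  have hw : inner ℝ x w = 0 := by
    simp only [w, inner_sub_right, inner_smul_right, hxx, a]; ring
  have hv : v = a • x + w := by simp [w]
  have hHx : hessian U x x = (α * (α + 1) * U x) • x := by
    rw [hU.hessian_self hξ.mem, hU.gradient_eq_smul hξ, smul_smul]; congr 1; ring
  have hHw : inner ℝ (hessian U x w) x = 0 := by
    rw [inner_hessian_comm ((hU.contDiffAt hξ.mem).of_le (by norm_num)), hHx, inner_smul_left, hw]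
    simp
  have hn : ‖v‖ ^ 2 = a ^ 2 + ‖w‖ ^ 2 := by
    rw [← real_inner_self_eq_norm_sq, ← real_inner_self_eq_norm_sq, hv]
    simp only [inner_add_left, inner_add_right, inner_smul_left, inner_smul_right, hxx, hw,
      real_inner_comm x w]
    simp; ring
  have hq : inner ℝ (hessian U x v) v =
      a ^ 2 * (α * (α + 1) * U x) + inner ℝ (hessian U x w) w := by
    rw [hv]
    simp only [map_add, map_smul, hHx, inner_add_left, inner_add_right, inner_smul_left,
      inner_smul_right, hxx, hw, hHw]
    simp; ring
  have hwle := mul_le_mul_of_nonneg_left (hU.le_inner_hessian_of_isLeast hξ.mem hν hw)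
    (inv_pos.2 hΩp).le
  have h1 : m * a ^ 2 ≤ 4⁻¹ * a ^ 2 :=
    mul_le_mul_of_nonneg_right (min_le_left _ _) (sq_nonneg a)
  have h2 : m * ‖w‖ ^ 2 ≤ (4⁻¹ + Ω⁻¹ * (ν - α * U x)) * ‖w‖ ^ 2 :=
    mul_le_mul_of_nonneg_right (min_le_right _ _) (by positivity)
  have h3 : 0 ≤ Ω⁻¹ * (a ^ 2 * (α * (α + 1) * U x)) := by positivity
  rw [hn, hq]
  linarith

end IsHomogeneousPotential

/-- A coercive operator is brought into a disc: `‖A - κ‖ < κ` for `κ` large. -/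
theorem exists_norm_sub_smul_id_lt {E : Type*} [NormedAddCommGroup E] [InnerProductSpace ℝ E]
    (A : E →L[ℝ] E) {m : ℝ} (hm : 0 < m) (hA : ∀ v, m * ‖v‖ ^ 2 ≤ inner ℝ (A v) v) :
    ∃ κ : ℝ, 0 < κ ∧ ‖A - κ • ContinuousLinearMap.id ℝ E‖ < κ := by
  set κ : ℝ := (‖A‖ ^ 2 + m ^ 2) / m with hκ
  have hκp : 0 < κ := by positivity
  have hκm : κ * m = ‖A‖ ^ 2 + m ^ 2 := by rw [hκ]; field_simp
  have hκle : m ≤ κ := by rw [hκ, le_div_iff₀ hm]; nlinarith [sq_nonneg ‖A‖]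
  have hr : 0 ≤ κ ^ 2 - κ * m := by nlinarith
  refine ⟨κ, hκp, lt_of_le_of_lt (ContinuousLinearMap.opNorm_le_bound _
    (Real.sqrt_nonneg (κ ^ 2 - κ * m)) fun v => ?_) ?_⟩
  · refine abs_le_of_sq_le_sq' ?_ (by positivity) |>.2
    rw [mul_pow, Real.sq_sqrt hr]
    have h1 : ‖(A - κ • ContinuousLinearMap.id ℝ E) v‖ ^ 2 =
        ‖A v‖ ^ 2 - 2 * κ * inner ℝ (A v) v + κ ^ 2 * ‖v‖ ^ 2 := by
      have : (A - κ • ContinuousLinearMap.id ℝ E) v = A v - κ • v := by simp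
      rw [this, norm_sub_sq_real, inner_smul_right, norm_smul, mul_pow, Real.norm_eq_abs, sq_abs]
      ring
    have h2 : ‖A v‖ ^ 2 ≤ ‖A‖ ^ 2 * ‖v‖ ^ 2 := by
      rw [← mul_pow]; exact pow_le_pow_left₀ (norm_nonneg _) (A.le_opNorm v) 2
    have h3 := mul_le_mul_of_nonneg_left (hA v) hκp.le
    nlinarith [sq_nonneg ‖v‖, sq_nonneg (m * ‖v‖)]
  · rw [Real.sqrt_lt' hκp]
    nlinarith [mul_pos hκp hm]

end Homogeneous

/-! ### Estimates in a truncated cone -/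

section Cone

variable {E : Type*} [NormedAddCommGroup E] [InnerProductSpace ℝ E]

theorem mem_coneSet_iff {ξ x : E} {R η : ℝ} (hR : 0 ≤ R) :
    x ∈ coneSet ξ R η ↔ R < ‖x‖ ∧ η * ‖x‖ < inner ℝ x ξ := by
  refine and_congr_right fun h => ?_
  rw [inner_smul_left, RCLike.conj_to_real, ← div_eq_inv_mul, lt_div_iff₀ (hR.trans_lt h)]

theorem isOpen_coneSet (ξ : E) {R : ℝ} (hR : 0 ≤ R) (η : ℝ) : IsOpen (coneSet ξ R η) := by
  have h : coneSet ξ R η = {x | R < ‖x‖} ∩ {x | η * ‖x‖ < inner ℝ x ξ} :=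
    Set.ext fun x => mem_coneSet_iff hR
  rw [h]
  exact (isOpen_lt (by fun_prop) (by fun_prop)).inter (isOpen_lt (by fun_prop) (by fun_prop))

theorem le_norm_smul_add {ξ z : E} {r δ : ℝ} (hξ : ‖ξ‖ = 1) (hr : 0 ≤ r) (hz : ‖z‖ ≤ δ) :
    r * (1 - δ) ≤ ‖r • (ξ + z)‖ := by
  rw [norm_smul, Real.norm_of_nonneg hr]
  refine mul_le_mul_of_nonneg_left ?_ hr
  have := norm_sub_le (ξ + z) z
  rw [add_sub_cancel_right, hξ] at this
  linarith

theorem smul_add_mem_coneSet {ξ z : E} {r R δ η : ℝ} (hξ : ‖ξ‖ = 1) (hR : 0 ≤ R) (hη : 0 ≤ η)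
    (hr : 0 < r) (hz : ‖z‖ ≤ δ) (hδ : η * (1 + δ) < 1 - δ) (hrR : R < r * (1 - δ)) :
    r • (ξ + z) ∈ coneSet ξ R η := by
  refine (mem_coneSet_iff hR).2 ⟨hrR.trans_le (le_norm_smul_add hξ hr.le hz), ?_⟩
  rw [norm_smul, Real.norm_of_nonneg hr.le, inner_smul_left, RCLike.conj_to_real, inner_add_left,
    real_inner_self_eq_norm_sq, hξ, mul_left_comm]
  refine mul_lt_mul_of_pos_left ?_ hr
  have h1 : ‖ξ + z‖ ≤ 1 + δ := by
    have := norm_add_le ξ z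
    rw [hξ] at this
    linarith
  have h2 : -δ ≤ inner ℝ z ξ := by
    have := (abs_le.1 (abs_real_inner_le_norm z ξ)).1
    rw [hξ, mul_one] at this
    linarith
  have := mul_le_mul_of_nonneg_left h1 hη
  linarith

variable [CompleteSpace E]

section Potential

variable {D : Set E} {W : ℝ → E → ℝ}

/-- Joint continuity of the spatial gradient, up to the boundary `t = 0`. -/
theorem continuousOn_uncurry_gradient (hD : IsOpen D)
    (hW : ContDiffOn ℝ 2 (Function.uncurry W) (Ici (0 : ℝ) ×ˢ D)) :
    ContinuousOn (fun y : ℝ × E => gradient (W y.1) y.2) (Ici (0 : ℝ) ×ˢ D) := by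
  have hu : UniqueDiffOn ℝ (Ici (0 : ℝ) ×ˢ D) := (uniqueDiffOn_Ici 0).prod hD.uniqueDiffOn
  have h1 := hW.continuousOn_fderivWithin hu (by norm_num)
  have h2 : ContinuousOn (fun y : ℝ × E => (InnerProductSpace.toDual ℝ E).symm
      ((fderivWithin ℝ (Function.uncurry W) (Ici (0 : ℝ) ×ˢ D) y) ∘L
        ContinuousLinearMap.inr ℝ ℝ E)) (Ici (0 : ℝ) ×ˢ D) :=
    (InnerProductSpace.toDual ℝ E).symm.continuous.comp_continuousOn
      (h1.clm_comp continuousOn_const)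
  refine h2.congr fun y hy => ?_
  have h3 := (hW.differentiableOn (by norm_num) y hy).hasFDerivWithinAt
  have h4 : HasFDerivWithinAt (fun x : E => (y.1, x)) (ContinuousLinearMap.inr ℝ ℝ E) D y.2 :=
    (hasFDerivAt_prodMk_right y.1 y.2).hasFDerivWithinAt
  have hmaps : MapsTo (fun x : E => (y.1, x)) D (Ici (0 : ℝ) ×ˢ D) := fun x hx => ⟨hy.1, hx⟩
  have h5 : HasFDerivWithinAt (W y.1)
      ((fderivWithin ℝ (Function.uncurry W) (Ici (0 : ℝ) ×ˢ D) y) ∘L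
        ContinuousLinearMap.inr ℝ ℝ E) D y.2 :=
    HasFDerivWithinAt.comp (g := Function.uncurry W) y.2 h3 h4 hmaps
  rw [gradient, (h5.hasFDerivAt (hD.mem_nhds hy.2)).fderiv]

omit [CompleteSpace E] in
theorem contDiffOn_slice {t : ℝ} (ht : 0 ≤ t)
    (hW : ContDiffOn ℝ 2 (Function.uncurry W) (Ici (0 : ℝ) ×ˢ D)) : ContDiffOn ℝ 2 (W t) D :=
  hW.comp (f := fun x : E => (t, x)) (by fun_prop) fun _ hx => ⟨ht, hx⟩

/-- The decay of `W`, in the form of a bound and of a Lipschitz bound for `∇W` on the balls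
`r • closedBall ξ δ`, which fill a cone around `ξ`. -/
theorem HasUniformDecay.exists_gradient_bounds {ξ : E} {R η β δ : ℝ} (hξ : ‖ξ‖ = 1)
    (hR : 0 ≤ R) (hη : 0 ≤ η) (hδ1 : δ ≤ 2⁻¹) (hδ : η * (1 + δ) < 1 - δ)
    (hβ : 0 < β) (hW : ContDiffOn ℝ 2 (Function.uncurry W) (Ici (0 : ℝ) ×ˢ coneSet ξ R η))
    (hWβ : HasUniformDecay β (coneSet ξ R η) W) :
    ∃ C r₀ : ℝ, 0 ≤ C ∧ 0 < r₀ ∧ R ≤ r₀ ∧ ∀ r, r₀ < r → ∀ z ∈ Metric.closedBall (0 : E) δ,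
      r • (ξ + z) ∈ coneSet ξ R η ∧ ∀ t, 0 ≤ t →
        ‖gradient (W t) (r • (ξ + z))‖ ≤ C * r ^ (-β - 1) ∧
        ∀ z' ∈ Metric.closedBall (0 : E) δ,
          ‖gradient (W t) (r • (ξ + z)) - gradient (W t) (r • (ξ + z'))‖ ≤
            C * r ^ (-β - 1) * ‖z - z'‖ := by
  obtain ⟨C, ρ, hC⟩ := hWβ
  set r₀ : ℝ := max (2 * R) (max (2 * ρ) 1) with hr₀
  have h1 : 2 * R ≤ r₀ := le_max_left _ _
  have h2 : 2 * ρ ≤ r₀ := (le_max_left _ _).trans (le_max_right _ _)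
  have h3 : 1 ≤ r₀ := (le_max_right _ _).trans (le_max_right _ _)
  have hmem : ∀ r, r₀ < r → ∀ z ∈ Metric.closedBall (0 : E) δ, r • (ξ + z) ∈ coneSet ξ R η ∧
      r / 2 ≤ ‖r • (ξ + z)‖ := by
    intro r hr z hz
    have hz' : ‖z‖ ≤ δ := mem_closedBall_zero_iff.1 hz
    have h4 : r / 2 ≤ r * (1 - δ) := by nlinarith
    refine ⟨smul_add_mem_coneSet hξ hR hη (by linarith) hz' hδ (by linarith),
      h4.trans (le_norm_smul_add hξ (by linarith) hz')⟩
  -- Powers of `‖x‖` with negative exponents are controlled by powers of `r` when `r / 2 ≤ ‖x‖`.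
  have hpow : ∀ r, 0 < r → ∀ x : E, r / 2 ≤ ‖x‖ → ∀ a : ℝ, 0 ≤ a →
      |C| * ‖x‖ ^ (-a) ≤ |C| * 2 ^ a * r ^ (-a) := by
    intro r hr x hx a ha
    rw [mul_assoc]
    refine mul_le_mul_of_nonneg_left ?_ (abs_nonneg C)
    refine (Real.rpow_le_rpow_of_nonpos (by positivity) hx (neg_nonpos.2 ha)).trans_eq ?_
    rw [Real.div_rpow hr.le (by norm_num), Real.rpow_neg (by norm_num : (0 : ℝ) ≤ 2), div_inv_eq_mul,
      mul_comm]
  have hb : ∀ r, r₀ < r → ∀ t, 0 ≤ t → ∀ x ∈ coneSet ξ R η, r / 2 ≤ ‖x‖ →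
      ‖gradient (W t) x‖ ≤ |C| * 2 ^ (β + 1) * r ^ (-(β + 1)) ∧
      ‖hessian (W t) x‖ ≤ |C| * 2 ^ (β + 2) * r ^ (-(β + 2)) := by
    intro r hr t ht x hx hxr
    have hr0 : 0 < r := by linarith
    have hx0 : 0 < ‖x‖ := by linarith
    have h4 := hC t ht x hx (by linarith)
    have h5 : C * ‖x‖ ^ (-β) ≤ |C| * ‖x‖ ^ (-β) :=
      mul_le_mul_of_nonneg_right (le_abs_self C) (by positivity)
    have h6 : 0 ≤ ‖x‖ * ‖gradient (W t) x‖ := by positivity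
    have h7 : 0 ≤ ‖x‖ ^ 2 * ‖hessian (W t) x‖ := by positivity
    have h8 := abs_nonneg (W t x)
    constructor
    · refine le_trans ?_ (hpow r hr0 x hxr (β + 1) (by linarith))
      have e : ‖x‖ ^ (-(β + 1)) = ‖x‖ ^ (-β) / ‖x‖ := by
        rw [← Real.rpow_sub_one hx0.ne']; ring_nf
      rw [e, ← mul_div_assoc, le_div_iff₀ hx0]
      linarith
    · refine le_trans ?_ (hpow r hr0 x hxr (β + 2) (by linarith))
      have e : ‖x‖ ^ (-(β + 2)) = ‖x‖ ^ (-β) / ‖x‖ ^ 2 := by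
        rw [← Real.rpow_natCast, ← Real.rpow_sub hx0]; norm_num; ring_nf
      rw [e, ← mul_div_assoc, le_div_iff₀ (by positivity)]
      linarith
  have h2pow : (2 : ℝ) ^ (β + 1) ≤ 2 ^ (β + 2) :=
    Real.rpow_le_rpow_of_exponent_le (by norm_num) (by linarith)
  refine ⟨|C| * 2 ^ (β + 2), r₀, by positivity, by linarith, by linarith, fun r hr z hz =>
    ⟨(hmem r hr z hz).1, fun t ht => ⟨?_, fun z' hz' => ?_⟩⟩⟩
  · have hr0 : 0 < r := by linarith
    rw [← neg_add' β 1]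
    refine (hb r hr t ht _ (hmem r hr z hz).1 (hmem r hr z hz).2).1.trans ?_
    gcongr
  · have hr0 : 0 < r := by linarith
    have hd : ∀ y ∈ Metric.closedBall (0 : E) δ,
        HasFDerivWithinAt (fun y => gradient (W t) (r • (ξ + y)))
          (hessian (W t) (r • (ξ + y)) ∘L (r • ContinuousLinearMap.id ℝ E))
          (Metric.closedBall (0 : E) δ) y := by
      intro y hy
      have hop := isOpen_coneSet ξ hR η
      have h4 : HasFDerivAt (gradient (W t)) (hessian (W t) (r • (ξ + y))) (r • (ξ + y)) :=
        ((((contDiffOn_slice ht hW).gradient_of_isOpen (m := 1) hop (by norm_num)).contDiffAt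
          (hop.mem_nhds (hmem r hr y hy).1)).differentiableAt (by norm_num)).hasFDerivAt
      exact (h4.comp y (((hasFDerivAt_id y).const_add ξ).const_smul r)).hasFDerivWithinAt
    have hbd : ∀ y ∈ Metric.closedBall (0 : E) δ,
        ‖hessian (W t) (r • (ξ + y)) ∘L (r • ContinuousLinearMap.id ℝ E)‖ ≤
          |C| * 2 ^ (β + 2) * r ^ (-β - 1) := by
      intro y hy
      have h5 := (hb r hr t ht _ (hmem r hr y hy).1 (hmem r hr y hy).2).2
      have h6 : ‖r • ContinuousLinearMap.id ℝ E‖ ≤ r := by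
        rw [norm_smul, Real.norm_of_nonneg hr0.le]
        exact mul_le_of_le_one_right hr0.le ContinuousLinearMap.norm_id_le
      refine (ContinuousLinearMap.opNorm_comp_le _ _).trans ?_
      refine (mul_le_mul h5 h6 (norm_nonneg _) (by positivity)).trans_eq ?_
      rw [mul_assoc, ← Real.rpow_add_one hr0.ne']
      ring_nf
    exact (convex_closedBall (0 : E) δ).norm_image_sub_le_of_norm_hasFDerivWithin_le hd hbd hz' hz

end Potential

end Cone

/-! ### The equation in logarithmic time -/

section LogTime

variable {E : Type*} [NormedAddCommGroup E] [InnerProductSpace ℝ E] [CompleteSpace E]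

/-- The position at logarithmic time `τ` of the motion with deviation `p` from the homothetic
motion `l e ^ (q τ) ξ`. The deviation is measured in units of `l e ^ (τ / 2)`, which is the rate
separating the two families of solutions of the linearized equation. -/
noncomputable def logTimePosition (q l : ℝ) (ξ : E) (τ : ℝ) (p : E) : E :=
  (l * Real.exp (q * τ)) • (ξ + Real.exp (-(q - 1 / 2) * τ) • p)

/-- The right-hand side of the equation of motion for the deviation `ψ` from the homothetic
motion, which reads `ψ'' = ψ / 4 + logTimeForce τ ψ` where the physical time
is `t = t₀ (e ^ τ - 1)`. -/
noncomputable def logTimeForce (α q Ω l t₀ : ℝ) (U : E → ℝ) (W : ℝ → E → ℝ) (ξ : E) (τ : ℝ)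
    (p : E) : E :=
  (Ω⁻¹ * Real.exp ((q - 1 / 2) * τ)) •
      (gradient U (ξ + Real.exp (-(q - 1 / 2) * τ) • p) - gradient U ξ) +
    (Ω⁻¹ * l ^ (α + 1) * Real.exp (3 / 2 * τ)) •
      gradient (W (t₀ * (Real.exp τ - 1))) (logTimePosition q l ξ τ p)

variable {α : ℝ} {S : Set E} {U : E → ℝ} {ξ : E}

theorem IsHomogeneousPotential.exists_gradient_linearization
    (hU : IsHomogeneousPotential α S U) (hξ : ξ ∈ S) {ε : ℝ} (hε : 0 < ε) :
    ∃ δ : ℝ, 0 < δ ∧ ∀ z : E, ‖z‖ ≤ δ → ξ + z ∈ S ∧ ∀ z' : E, ‖z'‖ ≤ δ →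
      ‖gradient U (ξ + z) - gradient U (ξ + z') - hessian U ξ (z - z')‖ ≤ ε * ‖z - z'‖ := by
  have h1 : HasStrictFDerivAt (gradient U) (hessian U ξ) ξ :=
    (hU.contDiffOn_gradient.contDiffAt (hU.isOpen.mem_nhds hξ)).hasStrictFDerivAt (by norm_num)
  have h2 := (h1.isLittleO.def hε)
  rw [nhds_prod_eq] at h2
  obtain ⟨s, hs, hs'⟩ := eventually_prod_self_iff
    (r := fun y z => ‖gradient U y - gradient U z - hessian U ξ (y - z)‖ ≤ ε * ‖y - z‖) |>.1 h2
  obtain ⟨δ, hδ, hball⟩ := Metric.nhds_basis_closedBall.mem_iff.1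
    (inter_mem hs (hU.isOpen.mem_nhds hξ))
  have hmem : ∀ z : E, ‖z‖ ≤ δ → ξ + z ∈ s ∩ S := fun z hz =>
    hball (by simpa [Metric.mem_closedBall, dist_eq_norm] using hz)
  refine ⟨δ, hδ, fun z hz => ⟨(hmem z hz).2, fun z' hz' => ?_⟩⟩
  simpa using hs' _ (hmem z hz).1 _ (hmem z' hz').1

set_option maxHeartbeats 1000000 in
/-- Motions close to the homothetic one exist for all initial directions near `ξ` and all initial
distances `l` that are large enough. -/
theorem exists_logTime_solution [FiniteDimensional ℝ E] (hα0 : 0 < α) (hα2 : α < 2)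
    (hU : IsHomogeneousPotential α S U) (hξ : IsCentralConfiguration S U ξ)
    (hBS : BSCondition α U ξ) {R η : ℝ} (hR : 0 < R) (hη0 : 0 < η) (hη1 : η < 1)
    {W : ℝ → E → ℝ} (hW : ContDiffOn ℝ 2 (Function.uncurry W) (Ici (0 : ℝ) ×ˢ coneSet ξ R η))
    {β : ℝ} (hβ : 4 * β - 3 * α > 2) (hWβ : HasUniformDecay β (coneSet ξ R η) W)
    {q Ω : ℝ} (hq : (α + 2) * q = 2) (hΩ : Ω = (α + 2) ^ 2 * U ξ / 2) :
    ∃ δ l₀ : ℝ, 0 < δ ∧ R ≤ l₀ ∧ (∀ z : E, ‖z‖ ≤ δ → ξ + z ∈ S) ∧ ∀ l, l₀ < l →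
      (∀ τ, 0 ≤ τ → ∀ p : E, ‖p‖ ≤ δ → logTimePosition q l ξ τ p ∈ coneSet ξ R η) ∧
      ∀ t₀, 0 < t₀ → ∀ p : E, ‖p‖ ≤ δ → ∃ (ψ ψ' : ℝ → E) (M : ℝ), ψ 0 = p ∧ ∀ τ, 0 ≤ τ →
        ‖ψ τ‖ ≤ δ ∧ ‖ψ' τ‖ ≤ M ∧ HasDerivWithinAt ψ (ψ' τ) (Ici 0) τ ∧
        HasDerivWithinAt ψ'
          ((4 : ℝ)⁻¹ • ψ τ + logTimeForce α q Ω l t₀ U W ξ τ (ψ τ)) (Ici 0) τ := by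
  have hUp : 0 < U ξ := hU.pos ξ hξ.mem
  have hΩp : 0 < Ω := by rw [hΩ]; positivity
  have hβα : α < β := by linarith
  have hq2 : 1 / 2 < q := by nlinarith
  have hexpo : 3 / 2 - q * (β + 1) ≤ 0 := by nlinarith
  obtain ⟨m, hm, hcoer⟩ := hU.exists_coercive_linearization hα0 hξ hBS
  rw [← hΩ] at hcoer
  let A : E →L[ℝ] E := (4 : ℝ)⁻¹ • ContinuousLinearMap.id ℝ E + Ω⁻¹ • hessian U ξ
  obtain ⟨κ, hκ, hAκ⟩ := exists_norm_sub_smul_id_lt A hm fun v => by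
    simpa [A, inner_add_left, inner_smul_left, real_inner_self_eq_norm_sq] using hcoer v
  set a : ℝ := ‖A - κ • ContinuousLinearMap.id ℝ E‖ with ha
  have ha0 : 0 ≤ a := norm_nonneg _
  set ρ : ℝ := κ - a with hρ
  have hρ0 : 0 < ρ := sub_pos.2 hAκ
  obtain ⟨δ₁, hδ₁, hlin⟩ :=
    hU.exists_gradient_linearization hξ.mem (ε := Ω * (ρ / 4)) (by positivity)
  set δ : ℝ := min δ₁ ((1 - η) / 4) with hδdef
  have hδ : 0 < δ := lt_min hδ₁ (by linarith)
  have hδδ₁ : δ ≤ δ₁ := min_le_left _ _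
  have hδη : δ ≤ (1 - η) / 4 := min_le_right _ _
  have hηδ : η * (1 + δ) < 1 - δ := by nlinarith
  obtain ⟨C, r₀, hC, hr₀, hRr₀, hWb⟩ := hWβ.exists_gradient_bounds hξ.norm_eq_one hR.le hη0.le
    (by linarith) hηδ (by linarith) hW
  -- The perturbation becomes small at large distances because `α < β`.
  have hlim : Tendsto (fun l : ℝ => Ω⁻¹ * C * l ^ (α - β)) atTop (𝓝 0) := by
    have := (tendsto_rpow_neg_atTop (sub_pos.2 hβα)).const_mul (Ω⁻¹ * C)
    simpa using this
  obtain ⟨l₁, hl₁⟩ := eventually_atTop.1 (hlim.eventually_le_const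
    (show (0 : ℝ) < ρ * δ / 4 by positivity))
  refine ⟨δ, max r₀ l₁, hδ, hRr₀.trans (le_max_left _ _),
    fun z hz => (hlin z (hz.trans hδδ₁)).1, fun l hl => ?_⟩
  have hlr : r₀ < l := (le_max_left _ _).trans_lt hl
  have hl0 : 0 < l := hr₀.trans hlr
  have hK := hl₁ l ((le_max_right _ _).trans hl.le)
  set K : ℝ := Ω⁻¹ * C * l ^ (α - β) with hKdef
  have hK0 : 0 ≤ K := by positivity
  have hKρ : K ≤ ρ / 4 := by
    have := mul_le_of_le_one_right hρ0.le (show δ ≤ 1 by linarith)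
    linarith
  have hdecay : ∀ τ, 0 ≤ τ → Real.exp (-(q - 1 / 2) * τ) ≤ 1 := fun τ hτ =>
    Real.exp_le_one_iff.2 (by nlinarith)
  have hsmall : ∀ τ, 0 ≤ τ → ∀ p : E, ‖p‖ ≤ δ → ‖Real.exp (-(q - 1 / 2) * τ) • p‖ ≤ δ := by
    intro τ hτ p hp
    rw [norm_smul, Real.norm_eq_abs, Real.abs_exp]
    exact (mul_le_of_le_one_left (norm_nonneg _) (hdecay τ hτ)).trans hp
  have hrad : ∀ τ, 0 ≤ τ → r₀ < l * Real.exp (q * τ) := fun τ hτ =>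
    hlr.trans_le (le_mul_of_one_le_right hl0.le (Real.one_le_exp (by nlinarith)))
  have hcone : ∀ τ, 0 ≤ τ → ∀ p : E, ‖p‖ ≤ δ → logTimePosition q l ξ τ p ∈ coneSet ξ R η :=
    fun τ hτ p hp =>
      (hWb _ (hrad τ hτ) _ (mem_closedBall_zero_iff.2 (hsmall τ hτ p hp))).1
  refine ⟨hcone, fun t₀ ht₀ p hp => ?_⟩
  have htime : ∀ τ, 0 ≤ τ → 0 ≤ t₀ * (Real.exp τ - 1) := fun τ hτ =>
    mul_nonneg ht₀.le (sub_nonneg.2 (Real.one_le_exp hτ))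
  have hcoef : ∀ τ, 0 ≤ τ → Ω⁻¹ * l ^ (α + 1) * Real.exp (3 / 2 * τ) *
      (C * (l * Real.exp (q * τ)) ^ (-β - 1)) ≤ K := by
    intro τ hτ
    have h1 : (l * Real.exp (q * τ)) ^ (-β - 1) =
        l ^ (-β - 1) * Real.exp (q * τ * (-β - 1)) := by
      rw [Real.mul_rpow hl0.le (Real.exp_pos _).le, ← Real.exp_mul]
    have h2 : l ^ (α - β) = l ^ (α + 1) * l ^ (-β - 1) := by
      rw [← Real.rpow_add hl0]; ring_nf
    have h3 : Real.exp (3 / 2 * τ) * Real.exp (q * τ * (-β - 1)) ≤ 1 := by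
      rw [← Real.exp_add, Real.exp_le_one_iff]
      nlinarith
    have h4 := mul_le_mul_of_nonneg_left h3 hK0
    rw [h1]
    refine le_trans (le_of_eq ?_) (h4.trans_eq (mul_one K))
    rw [hKdef, h2]
    ring
  -- The nonlinearity that remains after subtraction of the scalar operator `κ`.
  let g : ℝ → E → E := fun τ y =>
    ((4 : ℝ)⁻¹ - κ) • y + logTimeForce α q Ω l t₀ U W ξ τ y
  have hgLip : ∀ τ, 0 ≤ τ → ∀ y ∈ Metric.closedBall (0 : E) δ,
      ∀ z ∈ Metric.closedBall (0 : E) δ, ‖g τ y - g τ z‖ ≤ (a + ρ / 4 + K) * ‖y - z‖ := by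
    intro τ hτ y hy z hz
    rw [mem_closedBall_zero_iff] at hy hz
    set e : ℝ := Real.exp (-(q - 1 / 2) * τ) with he
    set e' : ℝ := Real.exp ((q - 1 / 2) * τ) with he'
    have hee : e' * e = 1 := by rw [he, he', ← Real.exp_add, ← add_mul, add_neg_cancel, zero_mul, Real.exp_zero]
    have he0 : 0 < e := Real.exp_pos _
    have he'0 : 0 < e' := Real.exp_pos _
    have hyz : ‖e • y - e • z‖ = e * ‖y - z‖ := by
      rw [← smul_sub, norm_smul, Real.norm_of_nonneg he0.le]
    set rem : E := gradient U (ξ + e • y) - gradient U (ξ + e • z) -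
      hessian U ξ (e • y - e • z) with hrem
    set w : E := gradient (W (t₀ * (Real.exp τ - 1))) (logTimePosition q l ξ τ y) -
      gradient (W (t₀ * (Real.exp τ - 1))) (logTimePosition q l ξ τ z) with hw
    have h1 : g τ y - g τ z = (A - κ • ContinuousLinearMap.id ℝ E) (y - z) +
        (Ω⁻¹ * e') • rem + (Ω⁻¹ * l ^ (α + 1) * Real.exp (3 / 2 * τ)) • w := by
      have h2 : (Ω⁻¹ * e') • hessian U ξ (e • y - e • z) = Ω⁻¹ • hessian U ξ (y - z) := by
        rw [← smul_sub, map_smul, smul_smul, mul_assoc, hee, mul_one]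
      have h3 : (A - κ • ContinuousLinearMap.id ℝ E) (y - z) =
          ((4 : ℝ)⁻¹ - κ) • (y - z) + Ω⁻¹ • hessian U ξ (y - z) := by
        simp only [A, sub_apply, add_apply,
          smul_apply, ContinuousLinearMap.id_apply, sub_smul]
        abel
      rw [h3, ← h2, hrem, hw]
      simp only [g, logTimeForce, ← he, ← he', smul_sub]
      abel
    have h4 : ‖(Ω⁻¹ * e') • rem‖ ≤ ρ / 4 * ‖y - z‖ := by
      have h5 := (hlin (e • y) ((hsmall τ hτ y hy).trans hδδ₁)).2 (e • z)
        ((hsmall τ hτ z hz).trans hδδ₁)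
      rw [hyz] at h5
      rw [norm_smul, Real.norm_of_nonneg (by positivity)]
      refine (mul_le_mul_of_nonneg_left h5 (by positivity)).trans_eq ?_
      have : Ω⁻¹ * e' * (Ω * (ρ / 4) * (e * ‖y - z‖)) =
        (Ω⁻¹ * Ω) * (e' * e) * (ρ / 4 * ‖y - z‖) := by ring
      rw [this, hee, inv_mul_cancel₀ hΩp.ne', one_mul, one_mul]
    have h6 : ‖(Ω⁻¹ * l ^ (α + 1) * Real.exp (3 / 2 * τ)) • w‖ ≤ K * ‖y - z‖ := by
      have h7 := ((hWb _ (hrad τ hτ) (e • y)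
        (mem_closedBall_zero_iff.2 (hsmall τ hτ y hy))).2 _ (htime τ hτ)).2 (e • z)
        (mem_closedBall_zero_iff.2 (hsmall τ hτ z hz))
      rw [hyz] at h7
      have h8 : e * ‖y - z‖ ≤ ‖y - z‖ :=
        mul_le_of_le_one_left (norm_nonneg _) (hdecay τ hτ)
      rw [norm_smul, Real.norm_of_nonneg (by positivity)]
      refine (mul_le_mul_of_nonneg_left h7 (by positivity)).trans ?_
      rw [← mul_assoc]
      exact mul_le_mul (hcoef τ hτ) h8 (by positivity) hK0
    rw [h1]
    refine (norm_add₃_le).trans ?_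
    have h9 := (A - κ • ContinuousLinearMap.id ℝ E).le_opNorm (y - z)
    rw [← ha] at h9
    linarith
  have hg0 : ∀ τ, 0 ≤ τ → ‖g τ 0‖ ≤ (√κ ^ 2 - (a + ρ / 4 + K)) * δ := by
    intro τ hτ
    have h1 : g τ 0 = (Ω⁻¹ * l ^ (α + 1) * Real.exp (3 / 2 * τ)) •
        gradient (W (t₀ * (Real.exp τ - 1))) (logTimePosition q l ξ τ 0) := by
      simp [g, logTimeForce]
    have h2 := ((hWb _ (hrad τ hτ) (Real.exp (-(q - 1 / 2) * τ) • 0)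
      (mem_closedBall_zero_iff.2 (hsmall τ hτ 0 (by simpa using hδ.le)))).2 _ (htime τ hτ)).1
    rw [h1, norm_smul, Real.norm_of_nonneg (by positivity), Real.sq_sqrt hκ.le]
    refine (mul_le_mul_of_nonneg_left h2 (by positivity)).trans ((hcoef τ hτ).trans ?_)
    have h3 := mul_le_mul_of_nonneg_right hKρ hδ.le
    have h4 := mul_pos hρ0 hδ
    rw [show κ = a + ρ by rw [hρ]; ring]
    linarith
  have hgc : ContinuousOn (Function.uncurry g) (Ici (0 : ℝ) ×ˢ Metric.closedBall 0 δ) := by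
    have hU1 : ContinuousOn (fun y : ℝ × E => gradient U (ξ + Real.exp (-(q - 1 / 2) * y.1) • y.2))
        (Ici (0 : ℝ) ×ˢ Metric.closedBall 0 δ) :=
      hU.contDiffOn_gradient.continuousOn.comp
        (f := fun y : ℝ × E => ξ + Real.exp (-(q - 1 / 2) * y.1) • y.2) (by fun_prop) fun y hy =>
          (hlin _ ((hsmall y.1 hy.1 y.2 (mem_closedBall_zero_iff.1 hy.2)).trans hδδ₁)).1
    have hW1 : ContinuousOn (fun y : ℝ × E => gradient (W (t₀ * (Real.exp y.1 - 1)))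
        (logTimePosition q l ξ y.1 y.2)) (Ici (0 : ℝ) ×ˢ Metric.closedBall 0 δ) :=
      (continuousOn_uncurry_gradient (isOpen_coneSet ξ hR.le η) hW).comp
        (f := fun y : ℝ × E => (t₀ * (Real.exp y.1 - 1), logTimePosition q l ξ y.1 y.2))
        (by unfold logTimePosition; fun_prop) fun y hy =>
          ⟨htime y.1 hy.1, hcone y.1 hy.1 y.2 (mem_closedBall_zero_iff.1 hy.2)⟩
    change ContinuousOn (fun y : ℝ × E => ((4 : ℝ)⁻¹ - κ) • y.2 +
      ((Ω⁻¹ * Real.exp ((q - 1 / 2) * y.1)) •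
        (gradient U (ξ + Real.exp (-(q - 1 / 2) * y.1) • y.2) - gradient U ξ) +
      (Ω⁻¹ * l ^ (α + 1) * Real.exp (3 / 2 * y.1)) •
        gradient (W (t₀ * (Real.exp y.1 - 1))) (logTimePosition q l ξ y.1 y.2))) _
    fun_prop
  obtain ⟨ψ, ψ', M, hψ0, hψ⟩ := exists_bounded_solution (k := √κ) (L := a + ρ / 4 + K)
    (Real.sqrt_pos.2 hκ) (by positivity) (by rw [Real.sq_sqrt hκ.le]; linarith) hδ.le hp hgc
    hgLip hg0
  refine ⟨ψ, ψ', M, hψ0, fun τ hτ => ?_⟩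
  obtain ⟨h1, h2, h3, h4⟩ := hψ τ hτ
  refine ⟨h1, h2, h3, h4.congr_deriv ?_⟩
  rw [Real.sq_sqrt hκ.le]
  simp only [g, sub_smul]
  abel

end LogTime

/-! ### Parabolic solutions -/

section Parabolic

variable {E : Type*} [NormedAddCommGroup E] [InnerProductSpace ℝ E]
  {α q Ω l t₀ : ℝ} {S : Set E} {U : E → ℝ} {W : ℝ → E → ℝ} {ξ : E} {ψ ψ' : ℝ → E}

/-- The physical velocity at logarithmic time `τ`, for a deviation `p` with `τ`-derivative `p'`. -/
noncomputable def logTimeVelocity (q l t₀ : ℝ) (ξ : E) (τ : ℝ) (p p' : E) : E :=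
  (l / t₀) • ((q * Real.exp ((q - 1) * τ)) • ξ +
    Real.exp (-(1 / 2) * τ) • ((2 : ℝ)⁻¹ • p + p'))

theorem logTimePosition_eq (q l : ℝ) (ξ : E) (τ : ℝ) (p : E) :
    logTimePosition q l ξ τ p =
      l • (Real.exp (q * τ) • ξ + Real.exp (1 / 2 * τ) • p) := by
  have h : Real.exp (1 / 2 * τ) = Real.exp (q * τ) * Real.exp (-(q - 1 / 2) * τ) := by
    rw [← Real.exp_add]; ring_nf
  rw [logTimePosition, h, mul_smul, smul_add, smul_smul (Real.exp (q * τ))]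

theorem hasDerivWithinAt_logTimePosition (ht₀ : t₀ ≠ 0) {s : Set ℝ} {τ : ℝ} {p' : E}
    (h : HasDerivWithinAt ψ p' s τ) :
    HasDerivWithinAt (fun σ => logTimePosition q l ξ σ (ψ σ))
      ((t₀ * Real.exp τ) • logTimeVelocity q l t₀ ξ τ (ψ τ) p') s τ := by
  simp only [logTimePosition_eq]
  have h1 := (((hasDerivAt_exp_mul q τ).hasDerivWithinAt (s := s)).smul_const ξ).add
    (((hasDerivAt_exp_mul (1 / 2) τ).hasDerivWithinAt (s := s)).smul h)
  refine (h1.const_smul l).congr_deriv ?_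
  have e1 : Real.exp (q * τ) = Real.exp τ * Real.exp ((q - 1) * τ) := by
    rw [← Real.exp_add]; ring_nf
  have e2 : Real.exp (1 / 2 * τ) = Real.exp τ * Real.exp (-(1 / 2) * τ) := by
    rw [← Real.exp_add]; ring_nf
  rw [logTimeVelocity, e1, e2]
  match_scalars <;> field_simp

variable [CompleteSpace E]

theorem hasDerivWithinAt_logTimeVelocity (hU : IsHomogeneousPotential α S U)
    (hξ : IsCentralConfiguration S U ξ) (hα : 0 < α) (hq : (α + 2) * q = 2)
    (hΩ : Ω = (α + 2) ^ 2 * U ξ / 2) (hl : 0 < l) (ht₀ : 0 < t₀)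
    (hlt : l ^ (α + 2) = Ω * t₀ ^ 2) {s : Set ℝ} {τ : ℝ}
    (hS : ξ + Real.exp (-(q - 1 / 2) * τ) • ψ τ ∈ S)
    (h : HasDerivWithinAt ψ (ψ' τ) s τ)
    (h' : HasDerivWithinAt ψ'
      ((4 : ℝ)⁻¹ • ψ τ + logTimeForce α q Ω l t₀ U W ξ τ (ψ τ)) s τ) :
    HasDerivWithinAt (fun σ => logTimeVelocity q l t₀ ξ σ (ψ σ) (ψ' σ))
      ((t₀ * Real.exp τ) • (gradient U (logTimePosition q l ξ τ (ψ τ)) +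
        gradient (W (t₀ * (Real.exp τ - 1))) (logTimePosition q l ξ τ (ψ τ)))) s τ := by
  have hUp : 0 < U ξ := hU.pos ξ hξ.mem
  have hΩp : 0 < Ω := by rw [hΩ]; positivity
  have h1 := (((hasDerivAt_exp_mul (q - 1) τ).const_mul q).hasDerivWithinAt (s := s)).smul_const ξ
  have h2 := ((hasDerivAt_exp_mul (-(1 / 2)) τ).hasDerivWithinAt (s := s)).smul
    ((h.const_smul (2 : ℝ)⁻¹).add h')
  refine ((h1.add h2).const_smul (l / t₀)).congr_deriv ?_
  have hgrad : gradient U (logTimePosition q l ξ τ (ψ τ)) =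
      (l ^ (-α - 1) * Real.exp ((q - 2) * τ)) •
        gradient U (ξ + Real.exp (-(q - 1 / 2) * τ) • ψ τ) := by
    rw [logTimePosition, hU.gradient_smul hS (by positivity),
      Real.mul_rpow hl.le (Real.exp_pos _).le, ← Real.exp_mul]
    congr 3
    linear_combination (-τ) * hq
  rw [hgrad]
  unfold logTimeForce
  set w := gradient (W (t₀ * (Real.exp τ - 1))) (logTimePosition q l ξ τ (ψ τ))
  set G := gradient U (ξ + Real.exp (-(q - 1 / 2) * τ) • ψ τ)
  -- The homothetic motion solves the unperturbed equation.
  have hG0 : gradient U ξ = (Ω * (q * (q - 1))) • ξ := by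
    rw [hU.gradient_eq_smul hξ, hΩ]
    congr 1
    have hq' : q = 2 / (α + 2) := by rw [eq_div_iff (by positivity)]; linarith
    rw [hq']
    field_simp
    ring
  rw [hG0]
  -- All exponentials and powers are expressed through independent ones.
  have e1 : Real.exp ((q - 1) * τ) = Real.exp τ * Real.exp ((q - 2) * τ) := by
    rw [← Real.exp_add]; ring_nf
  have e2 : Real.exp (-(1 / 2) * τ) * Real.exp ((q - 1 / 2) * τ) =
      Real.exp τ * Real.exp ((q - 2) * τ) := by
    rw [← Real.exp_add, ← Real.exp_add]; ring_nf
  have e3 : Real.exp (-(1 / 2) * τ) * Real.exp (3 / 2 * τ) = Real.exp τ := by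
    rw [← Real.exp_add]; ring_nf
  have e4 : l ^ (α + 1) = Ω * t₀ ^ 2 / l := by
    rw [← hlt, ← Real.rpow_sub_one hl.ne']; ring_nf
  have e5 : l ^ (-α - 1) = l / (Ω * t₀ ^ 2) := by
    rw [show -α - 1 = -(α + 1) by ring, Real.rpow_neg hl.le, e4, inv_div]
  rw [e1, e4, e5]
  simp only [Pi.add_apply, Pi.smul_apply]
  clear_value w G
  generalize Real.exp (-(1 / 2) * τ) = X at e2 e3 ⊢
  generalize Real.exp ((q - 1 / 2) * τ) = Y at e2 ⊢
  generalize Real.exp (3 / 2 * τ) = Z at e3 ⊢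
  generalize Real.exp ((q - 2) * τ) = Q at e2 ⊢
  match_scalars
  · field_simp
    linear_combination (-(l * q * (q - 1))) * e2
  · ring
  · ring
  · field_simp
    linear_combination e2
  · field_simp
    linear_combination e3

/-- A bounded solution in logarithmic time yields a parabolic motion in physical time that is
asymptotic to the homothetic one. -/
theorem isParabolicSolution_of_logTime (hU : IsHomogeneousPotential α S U)
    (hξ : IsCentralConfiguration S U ξ) (hα : 0 < α) (hα2 : α < 2) (hq : (α + 2) * q = 2)
    (hΩ : Ω = (α + 2) ^ 2 * U ξ / 2) (hl : 0 < l) (ht₀ : 0 < t₀)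
    (hlt : l ^ (α + 2) = Ω * t₀ ^ 2) {δ M : ℝ} {D : Set E}
    (hψ : ∀ τ, 0 ≤ τ → ‖ψ τ‖ ≤ δ) (hψ' : ∀ τ, 0 ≤ τ → ‖ψ' τ‖ ≤ M)
    (hS : ∀ z : E, ‖z‖ ≤ δ → ξ + z ∈ S)
    (hD : ∀ τ, 0 ≤ τ → ∀ p : E, ‖p‖ ≤ δ → logTimePosition q l ξ τ p ∈ D)
    (h : ∀ τ, 0 ≤ τ → HasDerivWithinAt ψ (ψ' τ) (Ici 0) τ)
    (h' : ∀ τ, 0 ≤ τ → HasDerivWithinAt ψ'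
      ((4 : ℝ)⁻¹ • ψ τ + logTimeForce α q Ω l t₀ U W ξ τ (ψ τ)) (Ici 0) τ) :
    ∃ x : ℝ → E, IsParabolicSolution U W (S ∩ D) x ∧ x 0 = l • (ξ + ψ 0) ∧
      Tendsto (fun t => ‖x t‖⁻¹ • x t) atTop (𝓝 ξ) ∧
      (fun t => ‖x t‖) ~[atTop] (fun t => (Ω ^ (1 / (α + 2))) * t ^ (2 / (α + 2))) := by
  have hUp : 0 < U ξ := hU.pos ξ hξ.mem
  have hΩp : 0 < Ω := by rw [hΩ]; positivity
  have hq2 : 1 / 2 < q := by nlinarith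
  have hq1 : q < 1 := by nlinarith
  have hq' : q = 2 / (α + 2) := by rw [eq_div_iff (by positivity)]; linarith
  -- The logarithmic time.
  let T : ℝ → ℝ := fun t => Real.log (1 + t / t₀)
  have hpos : ∀ t, 0 ≤ t → 1 ≤ 1 + t / t₀ := fun t ht => by
    have : 0 ≤ t / t₀ := by positivity
    linarith
  have hT0 : ∀ t, 0 ≤ t → 0 ≤ T t := fun t ht => Real.log_nonneg (hpos t ht)
  have hTexp : ∀ t, 0 ≤ t → Real.exp (T t) = 1 + t / t₀ := fun t ht =>
    Real.exp_log (by linarith [hpos t ht])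
  have hTmaps : MapsTo T (Ici 0) (Ici 0) := hT0
  have hTd : ∀ t, 0 ≤ t → HasDerivWithinAt T (t₀ * Real.exp (T t))⁻¹ (Ici 0) t := by
    intro t ht
    have h1 : HasDerivAt (fun s : ℝ => 1 + s / t₀) (1 / t₀) t :=
      ((hasDerivAt_id t).div_const t₀).const_add 1
    refine ((h1.log (by linarith [hpos t ht])).congr_deriv ?_).hasDerivWithinAt
    rw [hTexp t ht, div_div, one_div]
  have hTt : ∀ t, 0 ≤ t → t₀ * (Real.exp (T t) - 1) = t := by
    intro t ht
    rw [hTexp t ht]; field_simp; ring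
  have hTtop : Tendsto T atTop atTop :=
    Real.tendsto_log_atTop.comp (tendsto_atTop_add_const_left _ _
      (tendsto_id.atTop_div_const ht₀))
  let z : ℝ → E := fun t => Real.exp (-(q - 1 / 2) * T t) • ψ (T t)
  have hzle : ∀ τ, 0 ≤ τ → ‖Real.exp (-(q - 1 / 2) * τ) • ψ τ‖ ≤ δ := by
    intro τ hτ
    rw [norm_smul, Real.norm_eq_abs, Real.abs_exp]
    exact (mul_le_of_le_one_left (norm_nonneg _)
      (Real.exp_le_one_iff.2 (by nlinarith))).trans (hψ τ hτ)
  have hexp0 : ∀ c : ℝ, c < 0 → Tendsto (fun t => Real.exp (c * T t)) atTop (𝓝 0) :=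
    fun c hc => Real.tendsto_exp_atBot.comp (hTtop.const_mul_atTop_of_neg hc)
  have hz : Tendsto z atTop (𝓝 0) := by
    refine squeeze_zero_norm' (a := fun t => Real.exp (-(q - 1 / 2) * T t) * δ) ?_ ?_
    · filter_upwards [eventually_ge_atTop 0] with t ht
      rw [norm_smul, Real.norm_eq_abs, Real.abs_exp]
      exact mul_le_mul_of_nonneg_left (hψ _ (hT0 t ht)) (Real.exp_pos _).le
    · simpa using (hexp0 _ (by linarith)).mul_const δ
  have hξz : Tendsto (fun t => ξ + z t) atTop (𝓝 ξ) := by simpa using hz.const_add ξ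
  have hnorm : Tendsto (fun t => ‖ξ + z t‖) atTop (𝓝 1) := by
    simpa [hξ.norm_eq_one] using hξz.norm
  let r : ℝ → ℝ := fun t => l * Real.exp (q * T t)
  have hr : ∀ t, 0 < r t := fun t => by positivity
  have hrtop : Tendsto r atTop atTop :=
    (Real.tendsto_exp_atTop.comp (hTtop.const_mul_atTop (by linarith))).const_mul_atTop hl
  let x : ℝ → E := fun t => logTimePosition q l ξ (T t) (ψ (T t))
  have hx : ∀ t, x t = r t • (ξ + z t) := fun t => rfl
  have hxnorm : ∀ t, ‖x t‖ = r t * ‖ξ + z t‖ := fun t => by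
    rw [hx, norm_smul, Real.norm_of_nonneg (hr t).le]
  refine ⟨x, ⟨fun t => logTimeVelocity q l t₀ ξ (T t) (ψ (T t)) (ψ' (T t)), ?_, ?_, ?_, ?_, ?_⟩,
    ?_, ?_, ?_⟩
  · intro t ht
    exact ⟨hU.smul_mem _ (hS _ (hzle _ (hT0 t ht))) _ (hr t), hD _ (hT0 t ht) _ (hψ _ (hT0 t ht))⟩
  · intro t ht
    have h1 := (hasDerivWithinAt_logTimePosition (q := q) (l := l) (ξ := ξ) ht₀.ne'
      (h (T t) (hT0 t ht))).scomp t (hTd t ht) hTmaps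
    refine h1.congr_deriv ?_
    rw [smul_smul, inv_mul_cancel₀ (by positivity), one_smul]
  · intro t ht
    have h1 := (hasDerivWithinAt_logTimeVelocity hU hξ hα hq hΩ hl ht₀ hlt
      (hS _ (hzle _ (hT0 t ht))) (h (T t) (hT0 t ht)) (h' (T t) (hT0 t ht))).scomp t
      (hTd t ht) hTmaps
    refine h1.congr_deriv ?_
    rw [smul_smul, inv_mul_cancel₀ (by positivity), one_smul, hTt t ht]
  · simp only [hxnorm]
    exact hrtop.atTop_mul_pos one_pos hnorm
  · have h1 : Tendsto (fun t => (q * Real.exp ((q - 1) * T t)) • ξ) atTop (𝓝 0) := by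
      simpa using ((hexp0 (q - 1) (by linarith)).const_mul q).smul_const ξ
    have h2 : Tendsto (fun t => Real.exp (-(1 / 2) * T t) •
        ((2 : ℝ)⁻¹ • ψ (T t) + ψ' (T t))) atTop (𝓝 0) := by
      refine squeeze_zero_norm' (a := fun t => Real.exp (-(1 / 2) * T t) * (2⁻¹ * δ + M)) ?_ ?_
      · filter_upwards [eventually_ge_atTop 0] with t ht
        rw [norm_smul, Real.norm_eq_abs, Real.abs_exp]
        refine mul_le_mul_of_nonneg_left ((norm_add_le _ _).trans (add_le_add ?_
          (hψ' _ (hT0 t ht)))) (Real.exp_pos _).le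
        rw [norm_smul, Real.norm_of_nonneg (by norm_num)]
        exact mul_le_mul_of_nonneg_left (hψ _ (hT0 t ht)) (by norm_num)
      · simpa using (hexp0 (-(1 / 2)) (by norm_num)).mul_const (2⁻¹ * δ + M)
    simpa [logTimeVelocity] using (h1.add h2).const_smul (l / t₀)
  · simp [x, T, logTimePosition]
  · have h1 : Tendsto (fun t => ‖ξ + z t‖⁻¹ • (ξ + z t)) atTop (𝓝 ξ) := by
      simpa using (hnorm.inv₀ one_ne_zero).smul hξz
    refine h1.congr fun t => ?_
    rw [hxnorm, hx, smul_smul, mul_inv, mul_right_comm, inv_mul_cancel₀ (hr t).ne', one_mul]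
  · have h1 : Tendsto (fun t : ℝ => (1 + t₀ / t) ^ q * ‖ξ + z t‖) atTop (𝓝 1) := by
      have h2 : Tendsto (fun t : ℝ => 1 + t₀ / t) atTop (𝓝 1) := by
        simpa using (tendsto_const_nhds.div_atTop tendsto_id).const_add (1 : ℝ)
      simpa using (h2.rpow_const (p := q) (Or.inl one_ne_zero)).mul hnorm
    have hlq : l = Ω ^ (1 / (α + 2)) * t₀ ^ q := by
      have h3 : l = (l ^ (α + 2)) ^ (1 / (α + 2)) := by
        rw [← Real.rpow_mul hl.le, mul_one_div_cancel (by positivity), Real.rpow_one]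
      rw [h3, hlt, Real.mul_rpow hΩp.le (by positivity), ← Real.rpow_natCast t₀ 2,
        ← Real.rpow_mul ht₀.le, hq']
      push_cast
      rw [mul_one_div]
    refine isEquivalent_of_tendsto_one (h1.congr' ?_)
    filter_upwards [eventually_gt_atTop 0] with t ht
    have h4 : r t = Ω ^ (1 / (α + 2)) * t ^ (2 / (α + 2)) * (1 + t₀ / t) ^ q := by
      have h5 : Real.exp (q * T t) = (1 + t / t₀) ^ q := by
        rw [← hTexp t ht.le, ← Real.exp_mul, mul_comm]
      change l * Real.exp (q * T t) = _
      rw [h5, ← hq', mul_assoc, ← Real.mul_rpow ht.le (by positivity), hlq, mul_assoc,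
        ← Real.mul_rpow ht₀.le (by positivity)]
      congr 2
      field_simp
      ring
    rw [Pi.div_apply, hxnorm, h4]
    have : Ω ^ (1 / (α + 2)) * t ^ (2 / (α + 2)) ≠ 0 := by positivity
    field_simp

end Parabolic

theorem theorem1p1 (d : ℕ) (hd : 2 ≤ d) (μ : Fin d → ℝ) (hμ : ∀ j, 0 < μ j)
    (α : ℝ) (hα0 : 0 < α) (hα2 : α < 2)
    (S : Set (MassSpace μ hμ)) (U : MassSpace μ hμ → ℝ)
    (hU : IsHomogeneousPotential α S U)
    (ξ : MassSpace μ hμ) (hξ : IsCentralConfiguration S U ξ) (hBS : BSCondition α U ξ)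
    (R η : ℝ) (hR : 0 < R) (hη0 : 0 < η) (hη1 : η < 1)
    (W : ℝ → MassSpace μ hμ → ℝ)
    (hW : ContDiffOn ℝ 2 (Function.uncurry W) (Ici (0 : ℝ) ×ˢ coneSet ξ R η))
    (β : ℝ) (hβ : 4 * β - 3 * α > 2)
    (hWβ : HasUniformDecay β (coneSet ξ R η) W) :
    ∃ R' η' : ℝ, R ≤ R' ∧ η ≤ η' ∧ η' < 1 ∧ coneSet ξ R' η' ⊆ S ∧
      ∀ x₀ ∈ coneSet ξ R' η', ∃ x : ℝ → MassSpace μ hμ,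
        IsParabolicSolution U W (S ∩ coneSet ξ R η) x ∧
        x 0 = x₀ ∧
        Tendsto (fun t => ‖x t‖⁻¹ • x t) atTop (𝓝 ξ) ∧
        (fun t => ‖x t‖) ~[atTop]
          (fun t => ((α + 2) ^ 2 * U ξ / 2) ^ (1 / (α + 2)) * t ^ (2 / (α + 2))) := by
  have hq : (α + 2) * (2 / (α + 2)) = 2 := mul_div_cancel₀ _ (by positivity)
  set Ω : ℝ := (α + 2) ^ 2 * U ξ / 2 with hΩ
  have hΩp : 0 < Ω := by
    have := hU.pos ξ hξ.mem
    rw [hΩ]; positivity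
  obtain ⟨δ, l₀, hδ, hRl, hball, hsol⟩ :=
    exists_logTime_solution hα0 hα2 hU hξ hBS hR hη0 hη1 hW hβ hWβ hq hΩ
  -- A direction `u` with `⟪u, ξ⟫ > 1 - δ² / 2` satisfies `‖u - ξ‖ < δ`.
  have hdir : ∀ x₀ ∈ coneSet ξ l₀ (max η (1 - δ ^ 2 / 2)),
      0 < ‖x₀‖ ∧ l₀ < ‖x₀‖ ∧ ‖‖x₀‖⁻¹ • x₀ - ξ‖ ≤ δ ∧
        ‖x₀‖ • (ξ + (‖x₀‖⁻¹ • x₀ - ξ)) = x₀ := by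
    rintro x₀ ⟨h1, h2⟩
    have h3 : 0 < ‖x₀‖ := by linarith
    refine ⟨h3, h1, ?_, ?_⟩
    · have h4 := (le_max_right _ _).trans_lt h2
      have h5 : ‖‖x₀‖⁻¹ • x₀‖ = 1 := by
        rw [norm_smul, norm_inv, norm_norm, inv_mul_cancel₀ h3.ne']
      refine le_of_sq_le_sq ?_ hδ.le
      rw [norm_sub_sq_real, h5, hξ.norm_eq_one]
      linarith
    · rw [add_sub_cancel, smul_smul, mul_inv_cancel₀ h3.ne', one_smul]
  refine ⟨l₀, max η (1 - δ ^ 2 / 2), hRl, le_max_left _ _, max_lt hη1 (by nlinarith), ?_, ?_⟩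
  · intro x₀ hx₀
    obtain ⟨h1, -, h2, h3⟩ := hdir x₀ hx₀
    rw [← h3]
    exact hU.smul_mem _ (hball _ h2) _ h1
  · intro x₀ hx₀
    obtain ⟨h1, h2, h3, h4⟩ := hdir x₀ hx₀
    obtain ⟨hD, hex⟩ := hsol _ h2
    -- The time at which the homothetic parabolic motion is at distance `‖x₀‖`.
    have ht₀ : 0 < √(‖x₀‖ ^ (α + 2) / Ω) := Real.sqrt_pos.2 (by positivity)
    have hlt : ‖x₀‖ ^ (α + 2) = Ω * √(‖x₀‖ ^ (α + 2) / Ω) ^ 2 := by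
      rw [Real.sq_sqrt (by positivity), mul_div_cancel₀ _ hΩp.ne']
    obtain ⟨ψ, ψ', M, hψ0, hψ⟩ := hex _ ht₀ _ h3
    obtain ⟨x, hx, hx0, hxlim, hxeq⟩ := isParabolicSolution_of_logTime (D := coneSet ξ R η)
      (W := W) hU hξ hα0 hα2 hq hΩ h1 ht₀ hlt (fun τ hτ => (hψ τ hτ).1)
      (fun τ hτ => (hψ τ hτ).2.1) hball hD (fun τ hτ => (hψ τ hτ).2.2.1)
      (fun τ hτ => (hψ τ hτ).2.2.2)
    exact ⟨x, hx, by rw [hx0, hψ0, h4], hxlim, hxeq⟩
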